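/- **Rényi decomposition rule for mutual information.** Let $A,B$ be finite-dimensional quantum systems, let $\rho_{AB}$ be a density operator (positive semi-definite, trace one) on $AB$ with marginal $\rho_B=\operatorname{tr}_A\rho_{AB}$, and let $\tau_A\ge 0$ be an operator on $A$. Logarithms are to base $2$, negative powers are powers of the pseudoinverse, and $\sigma\gg\rho$ means $\ker\sigma\subseteq\ker\rho$. For $\alpha\in(0,1)\cup(1,\infty)$ the sandwiched Rényi divergence of a density operator $\rho$ relative to $\sigma\ge0$ is $$D_\alpha(\rho\|\sigma)=\frac1{\alpha-1}\log\operatorname{tr}\Big[\big(\sigma^{\frac{1-\alpha}{2\alpha}}\rho\,\sigma^{\frac{1-\alpha}{2\alpha}}\big)^\alpha\Big]\quad\text{if }\rho\sigma\ne0\text{ and }(\sigma\gg\rho\text{ or }\alpha<1),$$ and $D_\alpha(\rho\|\sigma)=+\infty$ otherwise; $D_1(\rho\|\sigma)=\operatorname{tr}\rho(\log\rho-\log\sigma)$ if $\sigma\gg\rho$ and $+\infty$ otherwise. Put $$H_\alpha(\rho_{AB}\|\tau_A)=-D_\alpha(\rho_{AB}\|\tau_A\otimes 1_B),\qquad I_\beta(\rho_{AB}\|\tau_A)=\inf_{\sigma_B}D_\beta(\rho_{AB}\|\tau_A\otimes\sigma_B),$$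 the infimum being over all density operators $\sigma_B$ on $B$, and let $H_\gamma(\rho)=\frac1{1-\gamma}\log\operatorname{tr}\rho^\gamma$ for $\gamma\in(0,1)\cup(1,\infty)$, $H_1(\rho)=-\operatorname{tr}\rho\log\rho$, $H_0(\rho)=\log\operatorname{rank}\rho$. Let $\alpha,\beta\ge\frac12$ and $\gamma\ge0$ be real numbers with $$\alpha\beta\gamma-2\beta\gamma-\alpha+\beta+\gamma=0$$ (if none of them is $1$, this says $\frac{\alpha}{\alpha-1}=\frac{\beta}{\beta-1}+\frac{\gamma}{\gamma-1}$), and assume that $\alpha,\beta<1$ or $\tau_A\otimes 1_B\gg\rho_{AB}$. Read $\frac1\gamma=+\infty$ if $\gamma=0$. 1. If $\frac1\beta+\frac1\gamma\le2$, and moreover $\alpha\le1$ in the case $\beta=\gamma=1$, then $I_\beta(\rho_{AB}\|\tau_A)\ge H_\gamma(\rho_B)-H_\alpha(\rho_{AB}\|\tau_A)$. 2. If $\frac1\beta+\frac1\gamma\ge2$, and moreover $\alpha\ge1$ in the case $\beta=\gamma=1$, then $I_\beta(\rho_{AB}\|\tau_A)\le H_\gamma(\rho_B)-H_\alpha(\rho_{AB}\|\tau_A)$.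 Both inequalities are between extended real numbers. -/

import Mathlib

open scoped Kronecker ComplexOrder

namespace RenyiDecomp

/-! Finite-dimensional quantum systems: a system is a finite index type `n` (an orthonormal basis of
its Hilbert space), operators on it are complex `n × n` matrices, and the composite of the systems
`A` and `B` is indexed by `A × B`, with tensor products given by Kronecker products. -/

/-- Density operators: positive semidefinite of unit trace. -/
def IsDensity {n : Type*} [Fintype n] (ρ : Matrix n n ℂ) : Prop :=
  ρ.PosSemidef ∧ ρ.trace = 1

/-- The marginal on `B` of an operator on `AB`, obtained by tracing out `A`. -/
def marginalB {A B : Type*} [Fintype A] (ρ : Matrix (A × B) (A × B) ℂ) : Matrix B B ℂ :=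
  Matrix.of fun j k => ∑ i, ρ (i, j) (i, k)

/-- `σ` dominates `ρ`: the kernel of `σ` is contained in the kernel of `ρ`. -/
def Dominates {n : Type*} [Fintype n] (σ ρ : Matrix n n ℂ) : Prop :=
  ∀ v : n → ℂ, σ.mulVec v = 0 → ρ.mulVec v = 0

/-- Two Hermitian operators are perpendicular when their supports are orthogonal subspaces,
that is, when their product vanishes. -/
def Perp {n : Type*} [Fintype n] (ρ σ : Matrix n n ℂ) : Prop :=
  ρ * σ = 0

/-- The power `M ^ p` of a positive semidefinite matrix, through its spectral decomposition. As
`(0 : ℝ) ^ p = 0` for `p ≠ 0`, negative powers are powers of the pseudoinverse. -/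
noncomputable def mpow {n : Type*} [Fintype n] [DecidableEq n] (M : Matrix n n ℂ) (p : ℝ) :
    Matrix n n ℂ :=
  cfc (fun x : ℝ => x ^ p) M

/-- The base-two logarithm of a positive semidefinite matrix, taken on its support (the eigenvalue
`0` is sent to `0`, which implements `0 log 0 = 0`). -/
noncomputable def mlog {n : Type*} [Fintype n] [DecidableEq n] (M : Matrix n n ℂ) :
    Matrix n n ℂ :=
  cfc (fun x : ℝ => Real.logb 2 x) M

open Classical in
/-- The sandwiched Rényi divergence `D_α(ρ‖σ)`, with values in the extended reals. At `α = 1` it is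
the quantum relative entropy. -/
noncomputable def renyiDiv {n : Type*} [Fintype n] [DecidableEq n] (α : ℝ)
    (ρ σ : Matrix n n ℂ) : EReal :=
  if α = 1 then
    if Dominates σ ρ then (((ρ * (mlog ρ - mlog σ)).trace.re : ℝ) : EReal) else ⊤
  else if ¬ Perp ρ σ ∧ (Dominates σ ρ ∨ α < 1) then
    ((1 / (α - 1) * Real.logb 2
      (mpow (mpow σ ((1 - α) / (2 * α)) * ρ * mpow σ ((1 - α) / (2 * α))) α).trace.re : ℝ) : EReal)
  else ⊤

/-- The quantum Rényi entropy `H_γ(ρ)`, `γ ≥ 0`: `log |supp ρ|` for `γ = 0`, the von Neumann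
entropy for `γ = 1`, and `(1 - γ)⁻¹ log tr ρ ^ γ` otherwise. -/
noncomputable def renyiEntropy {n : Type*} [Fintype n] [DecidableEq n] (γ : ℝ)
    (ρ : Matrix n n ℂ) : ℝ :=
  if γ = 0 then Real.logb 2 (ρ.rank : ℝ)
  else if γ = 1 then -(ρ * mlog ρ).trace.re
  else 1 / (1 - γ) * Real.logb 2 (mpow ρ γ).trace.re

/-- The generalised conditional entropy `H_α(ρ_AB‖τ_A) = -D_α(ρ_AB‖τ_A ⊗ 1_B)`. -/
noncomputable def condEntropy {A B : Type*} [Fintype A] [DecidableEq A] [Fintype B] [DecidableEq B]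
    (α : ℝ) (ρ : Matrix (A × B) (A × B) ℂ) (τ : Matrix A A ℂ) : EReal :=
  -renyiDiv α ρ (τ ⊗ₖ (1 : Matrix B B ℂ))

/-- The generalised mutual information `I_β(ρ_AB‖τ_A) = inf_{σ_B} D_β(ρ_AB‖τ_A ⊗ σ_B)`, the infimum
being over the density operators `σ_B` on `B`. -/
noncomputable def mutualInfo {A B : Type*} [Fintype A] [DecidableEq A] [Fintype B] [DecidableEq B]
    (β : ℝ) (ρ : Matrix (A × B) (A × B) ℂ) (τ : Matrix A A ℂ) : EReal :=
  ⨅ σ : {σ : Matrix B B ℂ // IsDensity σ}, renyiDiv β ρ (τ ⊗ₖ σ.1)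

end RenyiDecomp

/-!
Put `R = ρ ^ (1 / 2)` and let `‖X‖_p` be the Schatten norms. With `a = (1 - α) / (2 α)` the sandwiched
divergence is `D_α(ρ‖ω) = -(1 / a) log ‖R ω ^ a‖_p`, where `1 / p = 1 / 2 + a`. All quantities in the
theorem are therefore values of one function on a plane, `(a, b) ↦ log ‖R (τ ^ a ⊗ σ ^ b)‖_p`: the
conditional entropy at `(a, 0)`, the divergence relative to `τ ⊗ σ` at `(a', a')`, where
`a' = (1 - β) / (2 β)`, and a quantity that only depends on the marginal of `ρ` at `(0, b)`, where
`b = (γ - 1) / (2 γ)`. The relation between the orders says that these three points are collinear.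

Since `1 / p` is affine in `a`, complex interpolation makes the function convex along lines
(`schattenNorm_kronecker_le`). This is proved from Hadamard's three lines theorem and a Hölder
inequality for traces (`norm_trace_mul_fc_mul_fc_le`), which reduces to Young's inequality weighted
by the squared entries of two contractions. Which of the three points lies between the other two
depends on the position of the orders relative to `1`; the six possibilities are covered by the three
lemmas on `decompositionGap`. At `(0, b)` the Schatten norm is a 2-norm, whose square is
`tr ρ_B σ ^ (2 b)`. Hölder's inequality (`γ > 1`) or its reverse (`γ < 1`) compares it with
`(tr ρ_B ^ γ) ^ (1 / γ)` for every state `σ`, dominating `ρ_B` in the second case, with equality when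
`σ` is the escort state `ρ_B ^ γ / tr ρ_B ^ γ`. The lower bound uses every `σ`, the upper bound only
the escort state. For `γ = 0` the orders `α` and `β` agree, the escort state is the normalized
projection onto the support of `ρ_B`, and no interpolation is needed.

If one order is `1`, then so is a second one, and everything follows from the chain rule for the
relative entropy (`relEntropy_kronecker`), Klein's inequality, and the comparison of each order with
the order `1`. For the divergences the latter needs no limit: Hölder's inequality gives
`‖R ω ^ a‖_p ≥ tr ρ ^ (1 - a) ω ^ a`, and Jensen's inequality for the joint distribution of
eigenvalues bounds this below by `2 ^ (-a D_1(ρ‖ω))`, for `a` of either sign.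
-/

namespace RenyiDecomp

open Matrix

/-! ### Functional calculus and powers of Hermitian matrices -/

section

variable {n m : Type*} [Fintype n] [DecidableEq n] [Fintype m] [DecidableEq m]

open Classical in
/-- Functional calculus of a Hermitian matrix for complex-valued functions on the real line, through
the spectral decomposition; it is `0` when the matrix is not Hermitian. -/
noncomputable def fc (M : Matrix n n ℂ) (f : ℝ → ℂ) : Matrix n n ℂ :=
  if h : M.IsHermitian then
    (h.eigenvectorUnitary : Matrix n n ℂ) * diagonal (fun i => f (h.eigenvalues i)) *
      (h.eigenvectorUnitary : Matrix n n ℂ)ᴴ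
  else 0

lemma fc_eq {M : Matrix n n ℂ} (h : M.IsHermitian) (f : ℝ → ℂ) :
    fc M f = (h.eigenvectorUnitary : Matrix n n ℂ) * diagonal (fun i => f (h.eigenvalues i)) *
      (h.eigenvectorUnitary : Matrix n n ℂ)ᴴ := by
  simp [fc, h]

lemma eigenvectorUnitary_mul_conjTranspose {M : Matrix n n ℂ} (h : M.IsHermitian) :
    (h.eigenvectorUnitary : Matrix n n ℂ) * (h.eigenvectorUnitary : Matrix n n ℂ)ᴴ = 1 :=
  Unitary.coe_mul_star_self h.eigenvectorUnitary

lemma eigenvectorUnitary_conjTranspose_mul {M : Matrix n n ℂ} (h : M.IsHermitian) :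
    (h.eigenvectorUnitary : Matrix n n ℂ)ᴴ * (h.eigenvectorUnitary : Matrix n n ℂ) = 1 :=
  Unitary.coe_star_mul_self h.eigenvectorUnitary

lemma conj_diagonal_mul {U : Matrix n n ℂ} (hU : Uᴴ * U = 1) (d e : n → ℂ) :
    (U * diagonal d * Uᴴ) * (U * diagonal e * Uᴴ) = U * diagonal (fun i => d i * e i) * Uᴴ := by
  rw [← diagonal_mul_diagonal]
  calc _ = U * diagonal d * (Uᴴ * U) * diagonal e * Uᴴ := by simp only [Matrix.mul_assoc]
    _ = _ := by rw [hU, Matrix.mul_one]; simp only [Matrix.mul_assoc]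

lemma diagonal_const_mul {k : Type*} [DecidableEq k] (c : ℂ) (d : k → ℂ) :
    diagonal (fun i => c * d i) = c • diagonal d :=
  diagonal_smul c d

lemma fc_id {M : Matrix n n ℂ} (h : M.IsHermitian) : fc M (fun x => (x : ℂ)) = M := by
  rw [fc_eq h]
  conv_rhs => rw [h.spectral_theorem]
  rfl

lemma fc_mul {M : Matrix n n ℂ} (f g : ℝ → ℂ) :
    fc M f * fc M g = fc M (fun x => f x * g x) := by
  by_cases h : M.IsHermitian
  · simp only [fc_eq h, conj_diagonal_mul (eigenvectorUnitary_conjTranspose_mul h)]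
  · simp [fc, h]

lemma fc_add {M : Matrix n n ℂ} (f g : ℝ → ℂ) :
    fc M f + fc M g = fc M (fun x => f x + g x) := by
  by_cases h : M.IsHermitian
  · simp only [fc_eq h, ← Matrix.add_mul, ← Matrix.mul_add, diagonal_add]
  · simp [fc, h]

lemma fc_const_mul {M : Matrix n n ℂ} (c : ℂ) (f : ℝ → ℂ) :
    fc M (fun x => c * f x) = c • fc M f := by
  by_cases h : M.IsHermitian
  · simp only [fc_eq h, diagonal_const_mul, Matrix.mul_smul, Matrix.smul_mul]
  · simp [fc, h]

lemma fc_conjTranspose {M : Matrix n n ℂ} (f : ℝ → ℂ) :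
    (fc M f)ᴴ = fc M (fun x => star (f x)) := by
  by_cases h : M.IsHermitian
  · simp only [fc_eq h, conjTranspose_mul, conjTranspose_conjTranspose, diagonal_conjTranspose,
      Matrix.mul_assoc]
    rfl
  · simp [fc, h]

lemma fc_one {M : Matrix n n ℂ} (h : M.IsHermitian) : fc M (fun _ => 1) = 1 := by
  simp [fc_eq h, eigenvectorUnitary_mul_conjTranspose]

lemma fc_congr {M : Matrix n n ℂ} (h : M.PosSemidef) {f g : ℝ → ℂ} (hfg : ∀ x, 0 ≤ x → f x = g x) :
    fc M f = fc M g := by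
  simp only [fc_eq h.1, fun i => hfg _ (h.eigenvalues_nonneg i)]

lemma trace_fc {M : Matrix n n ℂ} (h : M.IsHermitian) (f : ℝ → ℂ) :
    (fc M f).trace = ∑ i, f (h.eigenvalues i) := by
  rw [fc_eq h, trace_mul_comm, ← Matrix.mul_assoc, eigenvectorUnitary_conjTranspose_mul,
    Matrix.one_mul, trace_diagonal]

lemma posSemidef_fc {M : Matrix n n ℂ} (h : M.PosSemidef) {f : ℝ → ℝ}
    (hf : ∀ x, 0 ≤ x → 0 ≤ f x) : (fc M (fun x => (f x : ℂ))).PosSemidef := by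
  rw [fc_eq h.1]
  refine PosSemidef.mul_mul_conjTranspose_same ?_ _
  refine posSemidef_diagonal_iff.2 fun i => ?_
  exact_mod_cast hf _ (h.eigenvalues_nonneg i)

lemma aeval_conj_diagonal {U : Matrix n n ℂ} (hU : Uᴴ * U = 1) (hU' : U * Uᴴ = 1) (d : n → ℂ)
    (q : Polynomial ℂ) :
    Polynomial.aeval (U * diagonal d * Uᴴ) q = U * diagonal (fun i => q.eval (d i)) * Uᴴ := by
  induction q using Polynomial.induction_on' with
  | add p q hp hq =>
    simp only [map_add, hp, hq, Polynomial.eval_add, ← diagonal_add, Matrix.mul_add, Matrix.add_mul]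
  | monomial k c =>
    have hk : (U * diagonal d * Uᴴ) ^ k = U * diagonal (fun i => d i ^ k) * Uᴴ := by
      induction k with
      | zero => simp [hU']
      | succ k ih => rw [pow_succ, ih, conj_diagonal_mul hU]; simp only [pow_succ]
    simp only [Polynomial.aeval_monomial, hk, Polynomial.eval_monomial]
    rw [← Algebra.smul_def]
    simp only [diagonal_const_mul, Matrix.mul_smul, Matrix.smul_mul]

/-- The functional calculus may be computed from any unitary diagonalization. -/
lemma fc_conj_diagonal {U : Matrix n n ℂ} (hU : Uᴴ * U = 1) (d : n → ℝ) (f : ℝ → ℂ) :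
    fc (U * diagonal (fun i => (d i : ℂ)) * Uᴴ) f = U * diagonal (fun i => f (d i)) * Uᴴ := by
  classical
  have hU' : U * Uᴴ = 1 := mul_eq_one_comm.1 hU
  have h : (U * diagonal (fun i => (d i : ℂ)) * Uᴴ).IsHermitian := by
    refine isHermitian_mul_mul_conjTranspose _ ?_
    simp [IsHermitian, diagonal_conjTranspose, Pi.star_def]
  -- a polynomial agreeing with `f` on both lists of eigenvalues evaluates both sides
  let s : Finset ℝ := Finset.univ.image d ∪ Finset.univ.image h.eigenvalues
  let q : Polynomial ℂ := Lagrange.interpolate s (fun x : ℝ => (x : ℂ)) f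
  have hq : ∀ x ∈ s, q.eval (x : ℂ) = f x := fun x hx =>
    Lagrange.eval_interpolate_at_node f (Complex.ofReal_injective.injOn) hx
  have h1 := aeval_conj_diagonal hU hU' (fun i => (d i : ℂ)) q
  have h2 := aeval_conj_diagonal (eigenvectorUnitary_conjTranspose_mul h)
    (eigenvectorUnitary_mul_conjTranspose h) (fun i => (h.eigenvalues i : ℂ)) q
  rw [← fc_eq h (fun x => (x : ℂ)), fc_id h, h1] at h2
  rw [fc_eq h]
  have e1 : ∀ i, q.eval (d i : ℂ) = f (d i) := fun i => hq _ (by simp [s])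
  have e2 : ∀ i, q.eval (h.eigenvalues i : ℂ) = f (h.eigenvalues i) := fun i => hq _ (by simp [s])
  simp only [e1, e2] at h2
  exact h2.symm

lemma fc_fc {M : Matrix n n ℂ} (h : M.IsHermitian) (f : ℝ → ℝ) (g : ℝ → ℂ) :
    fc (fc M (fun x => (f x : ℂ))) g = fc M (fun x => g (f x)) := by
  rw [fc_eq h (fun x => (f x : ℂ)),
    fc_conj_diagonal (eigenvectorUnitary_conjTranspose_mul h) (fun i => f (h.eigenvalues i)),
    fc_eq h]

/-- The unitary diagonalizing a Kronecker product of Hermitian matrices. -/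
noncomputable def kroneckerUnitary {M : Matrix n n ℂ} {N : Matrix m m ℂ} (hM : M.IsHermitian)
    (hN : N.IsHermitian) : Matrix (n × m) (n × m) ℂ :=
  (hM.eigenvectorUnitary : Matrix n n ℂ) ⊗ₖ (hN.eigenvectorUnitary : Matrix m m ℂ)

lemma fc_kronecker_fc {M : Matrix n n ℂ} {N : Matrix m m ℂ} (hM : M.IsHermitian)
    (hN : N.IsHermitian) (g h : ℝ → ℂ) :
    fc M g ⊗ₖ fc N h = kroneckerUnitary hM hN *
      diagonal (fun p : n × m => g (hM.eigenvalues p.1) * h (hN.eigenvalues p.2)) *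
      (kroneckerUnitary hM hN)ᴴ := by
  rw [kroneckerUnitary, fc_eq hM, fc_eq hN, mul_kronecker_mul, mul_kronecker_mul,
    diagonal_kronecker_diagonal, conjTranspose_kronecker]

lemma fc_kronecker_eq {M : Matrix n n ℂ} {N : Matrix m m ℂ} (hM : M.IsHermitian)
    (hN : N.IsHermitian) (f : ℝ → ℂ) :
    fc (M ⊗ₖ N) f = kroneckerUnitary hM hN *
      diagonal (fun p : n × m => f (hM.eigenvalues p.1 * hN.eigenvalues p.2)) *
      (kroneckerUnitary hM hN)ᴴ := by
  have hU : (kroneckerUnitary hM hN)ᴴ * kroneckerUnitary hM hN = 1 := by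
    rw [kroneckerUnitary, conjTranspose_kronecker, ← mul_kronecker_mul,
      eigenvectorUnitary_conjTranspose_mul, eigenvectorUnitary_conjTranspose_mul, one_kronecker_one]
  have key := fc_conj_diagonal hU (fun p => hM.eigenvalues p.1 * hN.eigenvalues p.2) f
  have e := fc_kronecker_fc hM hN (fun x => (x : ℂ)) (fun x => (x : ℂ))
  rw [fc_id hM, fc_id hN] at e
  simp only [Complex.ofReal_mul] at key
  rw [← e] at key
  exact key

lemma fc_kronecker {M : Matrix n n ℂ} {N : Matrix m m ℂ} (hM : M.IsHermitian) (hN : N.IsHermitian)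
    {f g h : ℝ → ℂ} (hf : ∀ i j, f (hM.eigenvalues i * hN.eigenvalues j) =
      g (hM.eigenvalues i) * h (hN.eigenvalues j)) :
    fc (M ⊗ₖ N) f = fc M g ⊗ₖ fc N h := by
  simp only [fc_kronecker_eq hM hN, fc_kronecker_fc hM hN, hf]

lemma mpow_eq_fc {M : Matrix n n ℂ} (h : M.IsHermitian) (p : ℝ) :
    mpow M p = fc M (fun x => ((x ^ p : ℝ) : ℂ)) := by
  rw [mpow, h.cfc_eq, fc_eq h]
  rfl

lemma mlog_eq_fc {M : Matrix n n ℂ} (h : M.IsHermitian) :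
    mlog M = fc M (fun x => ((Real.logb 2 x : ℝ) : ℂ)) := by
  rw [mlog, h.cfc_eq, fc_eq h]
  rfl

/-- The complex power `x ^ z` of a nonnegative real, with the value `0` at `x = 0` for every
exponent, so that `x ↦ pseudoPow 0 x` is the indicator of the nonzero reals. -/
noncomputable def pseudoPow (z : ℂ) (x : ℝ) : ℂ :=
  if x = 0 then 0 else Complex.exp (z * Real.log x)

lemma pseudoPow_mul (z w : ℂ) (x : ℝ) : pseudoPow z x * pseudoPow w x = pseudoPow (z + w) x := by
  unfold pseudoPow
  split_ifs <;> simp [add_mul, Complex.exp_add]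

lemma rpow_eq_pseudoPow {p : ℝ} (hp : p ≠ 0) {x : ℝ} (hx : 0 ≤ x) :
    ((x ^ p : ℝ) : ℂ) = pseudoPow p x := by
  unfold pseudoPow
  split_ifs with h
  · simp [h, hp]
  · rw [Real.rpow_def_of_pos (lt_of_le_of_ne hx (Ne.symm h))]
    push_cast
    rw [mul_comm]

lemma norm_pseudoPow_of_ne {z : ℂ} {x : ℝ} (hx : 0 ≤ x) (h0 : x ≠ 0) :
    ‖pseudoPow z x‖ = x ^ z.re := by
  rw [pseudoPow, if_neg h0, Complex.norm_exp, Real.rpow_def_of_pos (lt_of_le_of_ne hx (Ne.symm h0))]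
  simp [mul_comm]

lemma pseudoPow_ofReal_re (p x : ℝ) : pseudoPow p x = ((pseudoPow p x).re : ℂ) := by
  unfold pseudoPow
  split_ifs
  · simp
  · rw [← Complex.ofReal_mul, ← Complex.ofReal_exp, Complex.ofReal_re]

lemma pseudoPow_ofReal_mul (x y : ℝ) (z : ℂ) :
    pseudoPow z (x * y) = pseudoPow z x * pseudoPow z y := by
  unfold pseudoPow
  rcases eq_or_ne x 0 with h | h
  · simp [h]
  rcases eq_or_ne y 0 with h' | h'
  · simp [h']
  simp only [mul_eq_zero, h, h', or_self, if_false, Real.log_mul h h', ← Complex.exp_add]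
  push_cast
  ring_nf

/-- The power `M ^ z` of a positive semidefinite matrix for a complex exponent. It vanishes on the
kernel of `M` for every `z`, so at `z = 0` it is a projection, unlike `mpow M 0 = 1`. -/
noncomputable def mcpow (M : Matrix n n ℂ) (z : ℂ) : Matrix n n ℂ :=
  fc M (pseudoPow z)

/-- The orthogonal projection onto the support of a Hermitian matrix. -/
noncomputable def suppProj (M : Matrix n n ℂ) : Matrix n n ℂ :=
  mcpow M 0

lemma mcpow_mul (M : Matrix n n ℂ) (z w : ℂ) : mcpow M z * mcpow M w = mcpow M (z + w) := by
  simp only [mcpow, fc_mul, pseudoPow_mul]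

lemma mpow_eq_mcpow {M : Matrix n n ℂ} (h : M.PosSemidef) {p : ℝ} (hp : p ≠ 0) :
    mpow M p = mcpow M p := by
  rw [mpow_eq_fc h.1, mcpow]
  exact fc_congr h fun x hx => rpow_eq_pseudoPow hp hx

lemma mpow_one {M : Matrix n n ℂ} (h : M.IsHermitian) : mpow M 1 = M := by
  simp [mpow_eq_fc h, fc_id h]

lemma mcpow_one {M : Matrix n n ℂ} (h : M.PosSemidef) : mcpow M 1 = M := by
  rw [← Complex.ofReal_one, ← mpow_eq_mcpow h one_ne_zero, mpow_one h.1]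

lemma posSemidef_mpow {M : Matrix n n ℂ} (h : M.PosSemidef) (p : ℝ) : (mpow M p).PosSemidef := by
  rw [mpow_eq_fc h.1]
  exact posSemidef_fc h fun x hx => Real.rpow_nonneg hx p

lemma mcpow_kronecker {M : Matrix n n ℂ} {N : Matrix m m ℂ} (hM : M.IsHermitian)
    (hN : N.IsHermitian) (z : ℂ) : mcpow (M ⊗ₖ N) z = mcpow M z ⊗ₖ mcpow N z :=
  fc_kronecker hM hN fun _ _ => pseudoPow_ofReal_mul _ _ z

lemma mpow_kronecker {M : Matrix n n ℂ} {N : Matrix m m ℂ} (hM : M.PosSemidef)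
    (hN : N.PosSemidef) (p : ℝ) : mpow (M ⊗ₖ N) p = mpow M p ⊗ₖ mpow N p := by
  rw [mpow_eq_fc (hM.kronecker hN).1, mpow_eq_fc hM.1, mpow_eq_fc hN.1]
  refine fc_kronecker hM.1 hN.1 fun i j => ?_
  rw [Real.mul_rpow (hM.eigenvalues_nonneg i) (hN.eigenvalues_nonneg j)]
  push_cast
  rfl

lemma mpow_one_matrix (p : ℝ) : mpow (1 : Matrix n n ℂ) p = 1 := by
  have h : (1 : Matrix n n ℂ).IsHermitian := isHermitian_one
  have key := fc_conj_diagonal (U := (1 : Matrix n n ℂ)) (by simp) (fun _ => 1)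
    (fun x => ((x ^ p : ℝ) : ℂ))
  simp only [Complex.ofReal_one, Real.one_rpow, diagonal_one, Matrix.mul_one,
    conjTranspose_one] at key
  rw [mpow_eq_fc h, key]

lemma suppProj_mul_mcpow (M : Matrix n n ℂ) (z : ℂ) : suppProj M * mcpow M z = mcpow M z := by
  simp [suppProj, mcpow_mul]

lemma mcpow_mul_suppProj (M : Matrix n n ℂ) (z : ℂ) : mcpow M z * suppProj M = mcpow M z := by
  simp [suppProj, mcpow_mul]

lemma mul_suppProj {M : Matrix n n ℂ} (h : M.PosSemidef) : M * suppProj M = M := by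
  conv_lhs => rw [← mcpow_one h]
  rw [show suppProj (mcpow M 1) = suppProj M by rw [mcpow_one h], mcpow_mul_suppProj, mcpow_one h]

lemma mcpow_conjTranspose (M : Matrix n n ℂ) (z : ℂ) : (mcpow M z)ᴴ = mcpow M (star z) := by
  rw [mcpow, fc_conjTranspose, mcpow]
  congr 1
  funext x
  simp only [pseudoPow]
  split_ifs
  · simp
  · rw [Complex.star_def, ← Complex.exp_conj]
    simp

lemma suppProj_conjTranspose (M : Matrix n n ℂ) : (suppProj M)ᴴ = suppProj M := by
  rw [suppProj, mcpow_conjTranspose, star_zero]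

/-- Domination of positive semidefinite matrices says that the support projection of the
dominating matrix acts trivially. -/
lemma dominates_iff {σ ρ : Matrix n n ℂ} (hσ : σ.PosSemidef) :
    Dominates σ ρ ↔ ρ * suppProj σ = ρ := by
  constructor
  · intro h
    have h0 : σ * (1 - suppProj σ) = 0 := by rw [Matrix.mul_sub, mul_suppProj hσ]; simp
    have h1 : ρ * (1 - suppProj σ) = 0 := by
      ext i j
      have := h ((1 - suppProj σ).col j) (by
        ext i; simpa [Matrix.mul_apply, mulVec, dotProduct] using congrFun (congrFun h0 i) j)
      simpa [Matrix.mul_apply, mulVec, dotProduct] using congrFun this i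
    rw [Matrix.mul_sub, Matrix.mul_one, sub_eq_zero] at h1
    exact h1.symm
  · intro h v hv
    have h0 : suppProj σ = mcpow σ (-1) * σ := by
      nth_rewrite 3 [← mcpow_one hσ]
      rw [mcpow_mul, suppProj]
      congr 1
      norm_num
    rw [← h, h0, ← mulVec_mulVec, ← mulVec_mulVec, hv]
    simp

end

/-! ### Hölder's inequality for traces and eigenvector overlaps -/

/-- Weighted Hölder inequality for a doubly substochastic matrix `D` of weights. -/
lemma sum_mul_rpow_mul_rpow_le {n : Type*} [Fintype n] {D : n → n → ℝ} (hD : ∀ i j, 0 ≤ D i j) (hrow : ∀ i, ∑ j, D i j ≤ 1)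
    (hcol : ∀ j, ∑ i, D i j ≤ 1) {x y : n → ℝ} (hx : ∀ i, 0 ≤ x i) (hy : ∀ j, 0 ≤ y j)
    {u v : ℝ} (hu : 0 ≤ u) (hv : 0 ≤ v) (huv : u + v = 1) :
    ∑ i, ∑ j, D i j * (x i ^ u * y j ^ v) ≤ (∑ i, x i) ^ u * (∑ j, y j) ^ v := by
  have hrow' : ∀ z : n → ℝ, (∀ i, 0 ≤ z i) → ∑ i, ∑ j, D i j * z i ≤ ∑ i, z i := by
    intro z hz
    refine Finset.sum_le_sum fun i _ => ?_
    rw [← Finset.sum_mul]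
    nlinarith [hrow i, hz i]
  have hcol' : ∀ z : n → ℝ, (∀ i, 0 ≤ z i) → ∑ i, ∑ j, D i j * z j ≤ ∑ j, z j := by
    intro z hz
    rw [Finset.sum_comm]
    refine Finset.sum_le_sum fun j _ => ?_
    rw [← Finset.sum_mul]
    nlinarith [hcol j, hz j]
  rcases eq_or_lt_of_le hu with h0 | hu0
  · obtain rfl : v = 1 := by linarith
    simpa [← h0] using hcol' y hy
  rcases eq_or_lt_of_le hv with h0 | hv0
  · obtain rfl : u = 1 := by linarith
    simpa [← h0] using hrow' x hx
  have hX : 0 ≤ ∑ i, x i := Finset.sum_nonneg fun i _ => hx i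
  have hY : 0 ≤ ∑ i, y i := Finset.sum_nonneg fun i _ => hy i
  rcases eq_or_lt_of_le hX with hX0 | hX0
  · have : ∀ i, x i = 0 := fun i =>
      (Finset.sum_eq_zero_iff_of_nonneg fun i _ => hx i).1 hX0.symm i (Finset.mem_univ i)
    simp [this, hu0.ne']
  rcases eq_or_lt_of_le hY with hY0 | hY0
  · have : ∀ i, y i = 0 := fun i =>
      (Finset.sum_eq_zero_iff_of_nonneg fun i _ => hy i).1 hY0.symm i (Finset.mem_univ i)
    simp [this, hv0.ne']
  set X := ∑ i, x i with hXdef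
  set Y := ∑ i, y i with hYdef
  have hXY : 0 < X ^ u * Y ^ v := mul_pos (Real.rpow_pos_of_pos hX0 u) (Real.rpow_pos_of_pos hY0 v)
  have key : ∀ i j, x i ^ u * y j ^ v ≤ (X ^ u * Y ^ v) * (u * (x i / X) + v * (y j / Y)) := by
    intro i j
    have := Real.geom_mean_le_arith_mean2_weighted hu hv (div_nonneg (hx i) hX)
      (div_nonneg (hy j) hY) huv
    rw [Real.div_rpow (hx i) hX, Real.div_rpow (hy j) hY, div_mul_div_comm,
      div_le_iff₀ hXY] at this
    linarith
  calc ∑ i, ∑ j, D i j * (x i ^ u * y j ^ v)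
      ≤ ∑ i, ∑ j, D i j * ((X ^ u * Y ^ v) * (u * (x i / X) + v * (y j / Y))) :=
        Finset.sum_le_sum fun i _ => Finset.sum_le_sum fun j _ =>
          mul_le_mul_of_nonneg_left (key i j) (hD i j)
    _ = (X ^ u * Y ^ v) * (u / X * ∑ i, ∑ j, D i j * x i + v / Y * ∑ i, ∑ j, D i j * y j) := by
        simp only [Finset.mul_sum, ← Finset.sum_add_distrib]
        refine Finset.sum_congr rfl fun i _ => Finset.sum_congr rfl fun j _ => ?_
        ring
    _ ≤ (X ^ u * Y ^ v) * (u / X * X + v / Y * Y) := by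
        gcongr
        · exact hrow' x hx
        · exact hcol' y hy
    _ = X ^ u * Y ^ v := by
        rw [div_mul_cancel₀ _ hX0.ne', div_mul_cancel₀ _ hY0.ne', huv, mul_one]

section Contractions

open scoped Matrix.Norms.L2Operator

variable {n : Type*} [Fintype n] [DecidableEq n]

lemma l2_opNorm_diagonal_le_one {d : n → ℂ} (hd : ∀ i, ‖d i‖ ≤ 1) :
    ‖(diagonal d : Matrix n n ℂ)‖ ≤ 1 := by
  rw [l2_opNorm_diagonal]
  exact (pi_norm_le_iff_of_nonneg zero_le_one).2 hd

lemma l2_opNorm_le_one_of_conjTranspose_mul {C : Matrix n n ℂ} (h : ‖Cᴴ * C‖ ≤ 1) : ‖C‖ ≤ 1 := by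
  rw [l2_opNorm_conjTranspose_mul_self] at h
  nlinarith [norm_nonneg C]

lemma l2_opNorm_le_one_of_unitary {U : Matrix n n ℂ} (h : Uᴴ * U = 1) : ‖U‖ ≤ 1 := by
  apply l2_opNorm_le_one_of_conjTranspose_mul
  rw [h, ← diagonal_one]
  exact l2_opNorm_diagonal_le_one fun i => by simp

lemma l2_opNorm_mul_le_one {C D : Matrix n n ℂ} (hC : ‖C‖ ≤ 1) (hD : ‖D‖ ≤ 1) : ‖C * D‖ ≤ 1 :=
  (norm_mul_le C D).trans (mul_le_one₀ hC (norm_nonneg _) hD)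

lemma l2_opNorm_conjTranspose_le_one {C : Matrix n n ℂ} (hC : ‖C‖ ≤ 1) : ‖Cᴴ‖ ≤ 1 := by
  rwa [l2_opNorm_conjTranspose]

lemma l2_opNorm_fc_le_one {M : Matrix n n ℂ} (hM : M.IsHermitian) {f : ℝ → ℂ}
    (hf : ∀ i, ‖f (hM.eigenvalues i)‖ ≤ 1) : ‖fc M f‖ ≤ 1 := by
  rw [fc_eq hM]
  have hU := l2_opNorm_le_one_of_unitary (eigenvectorUnitary_conjTranspose_mul hM)
  exact l2_opNorm_mul_le_one (l2_opNorm_mul_le_one hU (l2_opNorm_diagonal_le_one hf))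
    (l2_opNorm_conjTranspose_le_one hU)

lemma sum_norm_sq_col_le_one {C : Matrix n n ℂ} (hC : ‖C‖ ≤ 1) (j : n) :
    ∑ i, ‖C i j‖ ^ 2 ≤ 1 := by
  have h := l2_opNorm_mulVec C (EuclideanSpace.single j 1)
  have h1 : ‖WithLp.toLp 2 (C *ᵥ (EuclideanSpace.single j (1 : ℂ)).ofLp)‖ ≤ 1 := by
    refine h.trans ?_
    simpa using hC
  rw [← sq_le_one_iff₀ (norm_nonneg _), EuclideanSpace.norm_sq_eq] at h1
  simpa using h1

lemma sum_norm_sq_row_le_one {C : Matrix n n ℂ} (hC : ‖C‖ ≤ 1) (i : n) :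
    ∑ j, ‖C i j‖ ^ 2 ≤ 1 := by
  simpa using sum_norm_sq_col_le_one (l2_opNorm_conjTranspose_le_one hC) i

/-- Hölder's inequality for the trace of a product of functions of two Hermitian matrices,
interlaced with contractions. The conjugate exponents are `1 / u` and `1 / v`; the endpoint
cases `u = 0` and `v = 0` are included. -/
lemma norm_trace_mul_fc_mul_fc_le {H K C Q : Matrix n n ℂ} (hH : H.IsHermitian)
    (hK : K.IsHermitian) (hC : ‖C‖ ≤ 1) (hQ : ‖Q‖ ≤ 1) {f g : ℝ → ℂ} {x y : n → ℝ}
    (hx : ∀ i, 0 ≤ x i) (hy : ∀ i, 0 ≤ y i) {u v : ℝ} (hu : 0 ≤ u) (hv : 0 ≤ v) (huv : u + v = 1)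
    (hf : ∀ i, ‖f (hH.eigenvalues i)‖ ≤ x i ^ u) (hg : ∀ i, ‖g (hK.eigenvalues i)‖ ≤ y i ^ v) :
    ‖(C * fc H f * Q * fc K g).trace‖ ≤ (∑ i, x i) ^ u * (∑ i, y i) ^ v := by
  set U : Matrix n n ℂ := (hH.eigenvectorUnitary : Matrix n n ℂ) with hU
  set V : Matrix n n ℂ := (hK.eigenvectorUnitary : Matrix n n ℂ) with hV
  have nU : ‖U‖ ≤ 1 := l2_opNorm_le_one_of_unitary (eigenvectorUnitary_conjTranspose_mul hH)
  have nV : ‖V‖ ≤ 1 := l2_opNorm_le_one_of_unitary (eigenvectorUnitary_conjTranspose_mul hK)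
  set C' := Vᴴ * C * U with hC'
  set Q' := Uᴴ * Q * V with hQ'
  have nC : ‖C'‖ ≤ 1 :=
    l2_opNorm_mul_le_one (l2_opNorm_mul_le_one (l2_opNorm_conjTranspose_le_one nV) hC) nU
  have nQ : ‖Q'‖ ≤ 1 :=
    l2_opNorm_mul_le_one (l2_opNorm_mul_le_one (l2_opNorm_conjTranspose_le_one nU) hQ) nV
  have htr : (C * fc H f * Q * fc K g).trace =
      ∑ i, ∑ j, C' j i * f (hH.eigenvalues i) * (Q' i j * g (hK.eigenvalues j)) := by
    have : (C * fc H f * Q * fc K g).trace = (C' * diagonal (fun i => f (hH.eigenvalues i)) *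
        (Q' * diagonal (fun i => g (hK.eigenvalues i)))).trace := by
      rw [fc_eq hH, fc_eq hK, ← hU, ← hV]
      rw [show C * (U * diagonal (fun i => f (hH.eigenvalues i)) * Uᴴ) * Q *
        (V * diagonal (fun i => g (hK.eigenvalues i)) * Vᴴ) = (C * U *
        diagonal (fun i => f (hH.eigenvalues i)) * Uᴴ * Q *
        V * diagonal (fun i => g (hK.eigenvalues i))) * Vᴴ by simp only [Matrix.mul_assoc],
        trace_mul_comm]
      simp only [hC', hQ', Matrix.mul_assoc]
    rw [this, trace, Finset.sum_comm]
    refine Finset.sum_congr rfl fun j _ => ?_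
    rw [diag_apply, mul_apply]
    refine Finset.sum_congr rfl fun i _ => ?_
    rw [mul_diagonal, mul_diagonal]
  set D : n → n → ℝ := fun i j => (‖C' j i‖ ^ 2 + ‖Q' i j‖ ^ 2) / 2 with hD
  refine le_trans ?_ (sum_mul_rpow_mul_rpow_le (D := D) (fun i j => by positivity) ?_ ?_ hx hy hu hv
    huv)
  · rw [htr]
    refine (norm_sum_le _ _).trans (Finset.sum_le_sum fun i _ => (norm_sum_le _ _).trans
      (Finset.sum_le_sum fun j _ => ?_))
    simp only [norm_mul]
    calc ‖C' j i‖ * ‖f (hH.eigenvalues i)‖ * (‖Q' i j‖ * ‖g (hK.eigenvalues j)‖)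
        = (‖C' j i‖ * ‖Q' i j‖) * (‖f (hH.eigenvalues i)‖ * ‖g (hK.eigenvalues j)‖) := by ring
      _ ≤ D i j * (x i ^ u * y j ^ v) := by
        apply mul_le_mul _ _ (by positivity) (by positivity)
        · simp only [hD]; nlinarith [sq_nonneg (‖C' j i‖ - ‖Q' i j‖)]
        · exact mul_le_mul (hf i) (hg j) (norm_nonneg _) (Real.rpow_nonneg (hx i) u)
  · intro i
    simp only [hD, ← Finset.sum_div, Finset.sum_add_distrib]
    linarith [sum_norm_sq_col_le_one nC i, sum_norm_sq_row_le_one nQ i]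
  · intro j
    simp only [hD, ← Finset.sum_div, Finset.sum_add_distrib]
    linarith [sum_norm_sq_row_le_one nC j, sum_norm_sq_col_le_one nQ j]

end Contractions

section Overlaps

variable {n : Type*} [Fintype n] [DecidableEq n]

/-- The squared moduli of the inner products between the eigenvectors of two Hermitian matrices. -/
noncomputable def overlap {M N : Matrix n n ℂ} (hM : M.IsHermitian) (hN : N.IsHermitian)
    (i j : n) : ℝ :=
  ‖((hM.eigenvectorUnitary : Matrix n n ℂ)ᴴ * (hN.eigenvectorUnitary : Matrix n n ℂ)) i j‖ ^ 2

variable {M N : Matrix n n ℂ} (hM : M.IsHermitian) (hN : N.IsHermitian)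

lemma overlap_nonneg (i j : n) : 0 ≤ overlap hM hN i j := sq_nonneg _

lemma trace_fc_mul_fc (f g : ℝ → ℂ) : (fc M f * fc N g).trace =
    ∑ i, ∑ j, (overlap hM hN i j : ℂ) * (f (hM.eigenvalues i) * g (hN.eigenvalues j)) := by
  set U : Matrix n n ℂ := (hM.eigenvectorUnitary : Matrix n n ℂ) with hU
  set V : Matrix n n ℂ := (hN.eigenvectorUnitary : Matrix n n ℂ) with hV
  have : (fc M f * fc N g).trace = (diagonal (fun i => f (hM.eigenvalues i)) * (Uᴴ * V) *
      (diagonal (fun i => g (hN.eigenvalues i)) * (Uᴴ * V)ᴴ)).trace := by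
    rw [fc_eq hM, fc_eq hN, ← hU, ← hV, conjTranspose_mul, conjTranspose_conjTranspose]
    rw [Matrix.mul_assoc, Matrix.mul_assoc, trace_mul_comm]
    simp only [Matrix.mul_assoc]
  rw [this, trace]
  refine Finset.sum_congr rfl fun i _ => ?_
  rw [diag_apply, mul_apply]
  refine Finset.sum_congr rfl fun j _ => ?_
  rw [diagonal_mul, diagonal_mul, conjTranspose_apply, overlap, ← hU, ← hV]
  rw [Complex.ofReal_pow, ← Complex.mul_conj']
  simp only [Complex.star_def]
  ring

lemma sum_overlap_row (i : n) : ∑ j, overlap hM hN i j = 1 := by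
  set U : Matrix n n ℂ := (hM.eigenvectorUnitary : Matrix n n ℂ) with hU
  set V : Matrix n n ℂ := (hN.eigenvectorUnitary : Matrix n n ℂ) with hV
  have h : (Uᴴ * V) * (Uᴴ * V)ᴴ = 1 := by
    rw [conjTranspose_mul, conjTranspose_conjTranspose,
      show Uᴴ * V * (Vᴴ * U) = Uᴴ * (V * Vᴴ) * U by simp only [Matrix.mul_assoc],
      eigenvectorUnitary_mul_conjTranspose, Matrix.mul_one, eigenvectorUnitary_conjTranspose_mul]
  have h1 := congrFun (congrFun h i) i
  rw [mul_apply, one_apply_eq] at h1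
  have h2 : ((∑ j, overlap hM hN i j : ℝ) : ℂ) = 1 := by
    rw [← h1]
    push_cast
    refine Finset.sum_congr rfl fun j _ => ?_
    rw [overlap, conjTranspose_apply, Complex.star_def, Complex.mul_conj', Complex.ofReal_pow]
  exact_mod_cast h2

lemma sum_overlap_col (j : n) : ∑ i, overlap hM hN i j = 1 := by
  rw [← sum_overlap_row hN hM j]
  refine Finset.sum_congr rfl fun i _ => ?_
  rw [overlap, overlap, ← norm_star, ← conjTranspose_apply, conjTranspose_mul,
    conjTranspose_conjTranspose]

lemma sum_overlap_mul_left (f : n → ℝ) : ∑ i, ∑ j, overlap hM hN i j * f i = ∑ i, f i := by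
  simp only [← Finset.sum_mul, sum_overlap_row, one_mul]

lemma sum_overlap_mul_right (f : n → ℝ) : ∑ i, ∑ j, overlap hM hN i j * f j = ∑ i, f i := by
  rw [Finset.sum_comm]
  simp only [← Finset.sum_mul, sum_overlap_col, one_mul]

/-- If `M` is dominated by `N`, eigenvectors of `M` with nonzero eigenvalue do not meet the kernel
of `N`. -/
lemma overlap_eq_zero_of_dominates {M N : Matrix n n ℂ} (hM : M.PosSemidef) (hN : N.PosSemidef)
    (h : M * suppProj N = M) {i j : n} (hi : hM.1.eigenvalues i ≠ 0)
    (hj : hN.1.eigenvalues j = 0) : overlap hM.1 hN.1 i j = 0 := by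
  have h0 : (fc M (fun x => (x : ℂ)) * fc N (fun x => 1 - pseudoPow 0 x)).trace = 0 := by
    have e : fc N (fun x => 1 - pseudoPow 0 x) = 1 - suppProj N := by
      have := fc_add (M := N) (fun x => 1 - pseudoPow 0 x) (pseudoPow 0)
      simp only [sub_add_cancel, fc_one hN.1] at this
      rw [← this]
      simp [suppProj, mcpow]
    rw [e, fc_id hM.1, Matrix.mul_sub, h]
    simp
  rw [trace_fc_mul_fc hM.1 hN.1] at h0
  have h1 : ∑ i, ∑ j, overlap hM.1 hN.1 i j *
      (hM.1.eigenvalues i * (if hN.1.eigenvalues j = 0 then 1 else 0)) = 0 := by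
    refine Complex.ofReal_eq_zero.1 (Eq.trans ?_ h0)
    push_cast
    refine Finset.sum_congr rfl fun i _ => Finset.sum_congr rfl fun j _ => ?_
    congr 2
    simp only [pseudoPow]
    split_ifs <;> simp
  have hpos : ∀ i j, 0 ≤ overlap hM.1 hN.1 i j *
      (hM.1.eigenvalues i * (if hN.1.eigenvalues j = 0 then 1 else 0)) := fun i j =>
    mul_nonneg (overlap_nonneg _ _ _ _) (mul_nonneg (hM.eigenvalues_nonneg i)
      (by split_ifs <;> norm_num))
  have h2 := (Finset.sum_eq_zero_iff_of_nonneg fun i _ => Finset.sum_nonneg fun j _ =>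
    hpos i j).1 h1 i (Finset.mem_univ i)
  have h3 := (Finset.sum_eq_zero_iff_of_nonneg fun j _ => hpos i j).1 h2 j (Finset.mem_univ j)
  simpa [hj, hi] using h3

end Overlaps

/-! ### Trace inequalities for two positive matrices -/

section

variable {n : Type*} [Fintype n] [DecidableEq n]

lemma sum_eigenvalues_of_isDensity {ρ : Matrix n n ℂ} (h : IsDensity ρ) :
    ∑ i, h.1.1.eigenvalues i = 1 := by
  have h1 : ((∑ i, h.1.1.eigenvalues i : ℝ) : ℂ) = 1 := by
    rw [Complex.ofReal_sum]
    exact h.1.1.trace_eq_sum_eigenvalues.symm.trans h.2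
  exact_mod_cast h1

lemma trace_mpow {ρ : Matrix n n ℂ} (h : ρ.PosSemidef) (p : ℝ) :
    (mpow ρ p).trace.re = ∑ i, h.1.eigenvalues i ^ p := by
  rw [mpow_eq_fc h.1, trace_fc h.1]
  simp

lemma trace_mul_mcpow_re {ρ σ : Matrix n n ℂ} (hρ : ρ.PosSemidef) (hσ : σ.PosSemidef) {p : ℝ}
    (hp : p ≠ 0) : (ρ * mcpow σ p).trace.re = ∑ i, ∑ j, overlap hρ.1 hσ.1 i j *
      (hρ.1.eigenvalues i * hσ.1.eigenvalues j ^ p) := by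
  rw [← mpow_eq_mcpow hσ hp, mpow_eq_fc hσ.1]
  nth_rewrite 1 [← fc_id hρ.1]
  rw [trace_fc_mul_fc hρ.1 hσ.1, ← Complex.ofReal_re (∑ i, ∑ j, overlap hρ.1 hσ.1 i j *
      (hρ.1.eigenvalues i * hσ.1.eigenvalues j ^ p))]
  congr 1
  push_cast
  rfl

lemma trace_mul_mcpow_le {ρ σ : Matrix n n ℂ} (hρ : ρ.PosSemidef) (hσ : IsDensity σ) {γ : ℝ}
    (hγ : 1 < γ) :
    (ρ * mcpow σ ((γ - 1) / γ : ℝ)).trace.re ≤ (mpow ρ γ).trace.re ^ (1 / γ) := by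
  have h0 : (0 : ℝ) < γ := by linarith
  have hp : 0 < (γ - 1) / γ := div_pos (by linarith) h0
  rw [trace_mul_mcpow_re hρ hσ.1 hp.ne', trace_mpow hρ]
  have key := sum_mul_rpow_mul_rpow_le (overlap_nonneg hρ.1 hσ.1.1)
    (fun i => (sum_overlap_row _ _ i).le) (fun j => (sum_overlap_col _ _ j).le)
    (x := fun i => hρ.1.eigenvalues i ^ γ) (y := fun i => hσ.1.1.eigenvalues i)
    (fun i => Real.rpow_nonneg (hρ.eigenvalues_nonneg i) _) (fun i => hσ.1.eigenvalues_nonneg i)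
    (u := 1 / γ) (v := (γ - 1) / γ) (by positivity) hp.le (by field_simp; ring)
  rw [sum_eigenvalues_of_isDensity hσ, Real.one_rpow, mul_one] at key
  refine le_trans (le_of_eq ?_) key
  refine Finset.sum_congr rfl fun i _ => Finset.sum_congr rfl fun j _ => ?_
  rw [← Real.rpow_mul (hρ.eigenvalues_nonneg i), mul_one_div_cancel h0.ne', Real.rpow_one]

/-- Reverse Young inequality, for the exponents `1 / γ > 1` and `1 - 1 / γ < 0`. -/
lemma add_le_rpow_mul_rpow_of_lt_one {x y γ : ℝ} (hx : 0 ≤ x) (hy : 0 < y) (h0 : 0 < γ)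
    (h1 : γ < 1) : x ^ γ / γ + (γ - 1) / γ * y ≤ x * y ^ ((γ - 1) / γ) := by
  have hz : 0 ≤ x * y ^ ((γ - 1) / γ) := mul_nonneg hx (Real.rpow_nonneg hy.le _)
  have key := Real.geom_mean_le_arith_mean2_weighted h0.le (by linarith : 0 ≤ 1 - γ) hz hy.le
    (by ring)
  rw [Real.mul_rpow hx (Real.rpow_nonneg hy.le _), ← Real.rpow_mul hy.le,
    div_mul_cancel₀ _ h0.ne', mul_assoc, ← Real.rpow_add hy, show γ - 1 + (1 - γ) = 0 by ring,
    Real.rpow_zero, mul_one] at key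
  have : x ^ γ / γ + (γ - 1) / γ * y = (x ^ γ - (1 - γ) * y) / γ := by field_simp; ring
  rw [this, div_le_iff₀ h0]
  linarith

lemma le_trace_mul_mcpow {ρ σ : Matrix n n ℂ} (hρ : ρ.PosSemidef) (hσ : IsDensity σ)
    (hdom : ρ * suppProj σ = ρ) {γ : ℝ} (h0 : 0 < γ) (h1 : γ < 1) :
    (mpow ρ γ).trace.re ^ (1 / γ) ≤ (ρ * mcpow σ ((γ - 1) / γ : ℝ)).trace.re := by
  have hp : (γ - 1) / γ < 0 := div_neg_of_neg_of_pos (by linarith) h0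
  rw [trace_mul_mcpow_re hρ hσ.1 hp.ne, trace_mpow hρ]
  set r := hρ.1.eigenvalues with hr
  set s := hσ.1.1.eigenvalues with hs
  have r0 : ∀ i, 0 ≤ r i := fun i => hρ.eigenvalues_nonneg i
  have s0 : ∀ i, 0 ≤ s i := fun i => hσ.1.eigenvalues_nonneg i
  set c := ∑ i, r i ^ γ with hc
  have c0 : 0 ≤ c := Finset.sum_nonneg fun i _ => Real.rpow_nonneg (r0 i) _
  rcases eq_or_lt_of_le c0 with hc0 | hc0
  · rw [← hc0, Real.zero_rpow (by positivity)]
    exact Finset.sum_nonneg fun i _ => Finset.sum_nonneg fun j _ =>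
      mul_nonneg (overlap_nonneg _ _ _ _) (mul_nonneg (r0 i) (Real.rpow_nonneg (s0 j) _))
  have hcp : 0 < c ^ (1 / γ) := Real.rpow_pos_of_pos hc0 _
  have key : ∀ i j, overlap hρ.1 hσ.1.1 i j * (r i ^ γ * (1 / (c * γ)) + (γ - 1) / γ * s j) ≤
      overlap hρ.1 hσ.1.1 i j * (r i * s j ^ ((γ - 1) / γ) / c ^ (1 / γ)) := by
    intro i j
    have hrr : (r i / c ^ (1 / γ)) ^ γ = r i ^ γ / c := by
      rw [Real.div_rpow (r0 i) hcp.le, ← Real.rpow_mul c0, one_div_mul_cancel h0.ne', Real.rpow_one]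
    rcases eq_or_lt_of_le (s0 j) with hj | hj
    · rcases eq_or_ne (r i) 0 with hi | hi
      · simp [hi, ← hj, h0.ne']
      · rw [overlap_eq_zero_of_dominates hρ hσ.1 hdom hi hj.symm]
        simp
    · apply mul_le_mul_of_nonneg_left _ (overlap_nonneg _ _ _ _)
      have := add_le_rpow_mul_rpow_of_lt_one (div_nonneg (r0 i) hcp.le) hj h0 h1
      rw [hrr] at this
      calc _ = r i ^ γ / c / γ + (γ - 1) / γ * s j := by field_simp
        _ ≤ _ := this
        _ = _ := by ring
  have hsum := Finset.sum_le_sum fun i (_ : i ∈ Finset.univ) => Finset.sum_le_sum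
    fun j (_ : j ∈ Finset.univ) => key i j
  have e1 : ∑ i, ∑ j, overlap hρ.1 hσ.1.1 i j * (r i ^ γ * (1 / (c * γ)) + (γ - 1) / γ * s j) =
      1 := by
    simp only [mul_add, Finset.sum_add_distrib]
    rw [sum_overlap_mul_left hρ.1 hσ.1.1 (fun i => r i ^ γ * (1 / (c * γ))),
      sum_overlap_mul_right hρ.1 hσ.1.1 (fun j => (γ - 1) / γ * s j), ← Finset.sum_mul,
      ← Finset.mul_sum, sum_eigenvalues_of_isDensity hσ, ← hc]
    field_simp
    ring
  rw [e1] at hsum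
  simp only [← mul_div_assoc, ← Finset.sum_div] at hsum
  rw [le_div_iff₀ hcp, one_mul] at hsum
  exact hsum

lemma trace_mul_mlog_sub_mlog {ρ σ : Matrix n n ℂ} (hρ : ρ.PosSemidef) (hσ : σ.PosSemidef) :
    (ρ * (mlog ρ - mlog σ)).trace.re = ∑ i, ∑ j, overlap hρ.1 hσ.1 i j * hρ.1.eigenvalues i *
      (Real.logb 2 (hρ.1.eigenvalues i) - Real.logb 2 (hσ.1.eigenvalues j)) := by
  have e1 : (ρ * mlog ρ).trace.re = ∑ i, ∑ j, overlap hρ.1 hσ.1 i j *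
      (hρ.1.eigenvalues i * Real.logb 2 (hρ.1.eigenvalues i)) := by
    rw [sum_overlap_mul_left hρ.1 hσ.1
      (fun i => hρ.1.eigenvalues i * Real.logb 2 (hρ.1.eigenvalues i)), mlog_eq_fc hρ.1]
    nth_rewrite 1 [← fc_id hρ.1]
    rw [fc_mul, trace_fc hρ.1]
    simp
  have e2 : (ρ * mlog σ).trace.re = ∑ i, ∑ j, overlap hρ.1 hσ.1 i j *
      (hρ.1.eigenvalues i * Real.logb 2 (hσ.1.eigenvalues j)) := by
    rw [mlog_eq_fc hσ.1]
    nth_rewrite 1 [← fc_id hρ.1]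
    rw [trace_fc_mul_fc hρ.1 hσ.1]
    refine Eq.trans ?_ (Complex.ofReal_re (∑ i, ∑ j, overlap hρ.1 hσ.1 i j *
      (hρ.1.eigenvalues i * Real.logb 2 (hσ.1.eigenvalues j))))
    push_cast
    rfl
  rw [Matrix.mul_sub, trace_sub, Complex.sub_re, e1, e2, ← Finset.sum_sub_distrib]
  refine Finset.sum_congr rfl fun i _ => ?_
  rw [← Finset.sum_sub_distrib]
  refine Finset.sum_congr rfl fun j _ => ?_
  ring

lemma trace_mcpow_mul_mcpow {ρ σ : Matrix n n ℂ} (hρ : ρ.PosSemidef) (hσ : σ.PosSemidef)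
    (a b : ℝ) : (mcpow ρ a * mcpow σ b).trace.re = ∑ i, ∑ j, overlap hρ.1 hσ.1 i j *
      ((pseudoPow a (hρ.1.eigenvalues i)).re * (pseudoPow b (hσ.1.eigenvalues j)).re) := by
  rw [mcpow, mcpow, trace_fc_mul_fc hρ.1 hσ.1]
  refine Eq.trans ?_ (Complex.ofReal_re (∑ i, ∑ j, overlap hρ.1 hσ.1 i j *
      ((pseudoPow a (hρ.1.eigenvalues i)).re * (pseudoPow b (hσ.1.eigenvalues j)).re)))
  push_cast
  simp only [← pseudoPow_ofReal_re]

/-- Jensen's inequality for the joint distribution of the eigenvalues of `ρ` and `σ`: the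
relative entropy bounds `tr ρ ^ (1 - a) σ ^ a` from below, for exponents of either sign. -/
lemma two_rpow_neg_mul_le_trace {ρ σ : Matrix n n ℂ} (hρ : IsDensity ρ) (hσ : σ.PosSemidef)
    (hdom : ρ * suppProj σ = ρ) (a : ℝ) :
    (2 : ℝ) ^ (-a * (ρ * (mlog ρ - mlog σ)).trace.re) ≤
      (mcpow ρ (1 - a : ℝ) * mcpow σ a).trace.re := by
  rw [trace_mul_mlog_sub_mlog hρ.1 hσ, trace_mcpow_mul_mcpow hρ.1 hσ]
  set r := hρ.1.1.eigenvalues with hr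
  set s := hσ.1.eigenvalues with hs
  have r0 : ∀ i, 0 ≤ r i := fun i => hρ.1.eigenvalues_nonneg i
  have key := convexOn_exp.map_sum_le (t := (Finset.univ : Finset (n × n)))
    (w := fun p => overlap hρ.1.1 hσ.1 p.1 p.2 * r p.1)
    (p := fun p => a * (Real.log (s p.2) - Real.log (r p.1)))
    (fun p _ => mul_nonneg (overlap_nonneg _ _ _ _) (r0 _))
    (by
      rw [Fintype.sum_prod_type, sum_overlap_mul_left hρ.1.1 hσ.1 r,
        sum_eigenvalues_of_isDensity hρ])
    (fun _ _ => Set.mem_univ _)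
  rw [Fintype.sum_prod_type, Fintype.sum_prod_type] at key
  simp only [smul_eq_mul] at key
  refine le_trans (le_of_eq ?_) (key.trans (le_of_eq ?_))
  · rw [Real.rpow_def_of_pos two_pos]
    congr 1
    simp only [Finset.mul_sum]
    refine Finset.sum_congr rfl fun i _ => Finset.sum_congr rfl fun j _ => ?_
    have : Real.log 2 ≠ 0 := (Real.log_pos one_lt_two).ne'
    simp only [Real.logb]
    field_simp
    ring
  · refine Finset.sum_congr rfl fun i _ => Finset.sum_congr rfl fun j _ => ?_
    rcases eq_or_ne (r i) 0 with hi | hi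
    · simp [hi, pseudoPow]
    rcases eq_or_ne (s j) 0 with hj | hj
    · rw [overlap_eq_zero_of_dominates hρ.1 hσ hdom hi hj]
      simp
    simp only [pseudoPow, hi, hj, if_false, ← Complex.ofReal_mul, ← Complex.ofReal_exp,
      Complex.ofReal_re]
    rw [mul_assoc, ← Real.exp_add]
    congr 1
    nth_rewrite 1 [← Real.exp_log (lt_of_le_of_ne (r0 i) (Ne.symm hi))]
    rw [← Real.exp_add]
    congr 1
    ring

/-- **Klein's inequality**: the relative entropy of density operators is nonnegative. -/
lemma trace_mul_mlog_sub_mlog_nonneg {ρ σ : Matrix n n ℂ} (hρ : IsDensity ρ) (hσ : IsDensity σ)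
    (hdom : ρ * suppProj σ = ρ) : 0 ≤ (ρ * (mlog ρ - mlog σ)).trace.re := by
  have h := two_rpow_neg_mul_le_trace hρ hσ.1 hdom 1
  have h1 : (mcpow ρ (1 - 1 : ℝ) * mcpow σ (1 : ℝ)).trace.re ≤ 1 := by
    rw [trace_mcpow_mul_mcpow hρ.1 hσ.1]
    refine le_trans ?_ ((sum_overlap_mul_right hρ.1.1 hσ.1.1 hσ.1.1.eigenvalues).trans
      (sum_eigenvalues_of_isDensity hσ)).le
    refine Finset.sum_le_sum fun i _ => Finset.sum_le_sum fun j _ =>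
      mul_le_mul_of_nonneg_left ?_ (overlap_nonneg _ _ _ _)
    rw [← rpow_eq_pseudoPow one_ne_zero (hσ.1.eigenvalues_nonneg j), Real.rpow_one,
      Complex.ofReal_re]
    refine mul_le_of_le_one_left (hσ.1.eigenvalues_nonneg j) ?_
    unfold pseudoPow
    split_ifs <;> simp
  have h2 := h.trans h1
  by_contra! hneg
  have := Real.one_lt_rpow one_lt_two (by linarith : 0 < -1 * (ρ * (mlog ρ - mlog σ)).trace.re)
  linarith

end

/-! ### Schatten norms and complex interpolation -/

section

variable {n : Type*} [Fintype n] [DecidableEq n]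

/-- The Schatten (quasi-)norm `(tr |X| ^ p) ^ (1 / p)`, parametrized by the reciprocal `u = 1 / p` of
its exponent, which is the parameter that interpolates affinely. -/
noncomputable def schattenNorm (u : ℝ) (X : Matrix n n ℂ) : ℝ :=
  (mpow (Xᴴ * X) (1 / (2 * u))).trace.re ^ u

lemma trace_mpow_nonneg {Y : Matrix n n ℂ} (hY : Y.PosSemidef) (p : ℝ) :
    0 ≤ (mpow Y p).trace.re := by
  rw [trace_mpow hY]
  exact Finset.sum_nonneg fun i _ => Real.rpow_nonneg (hY.eigenvalues_nonneg i) _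

lemma schattenNorm_nonneg (u : ℝ) (X : Matrix n n ℂ) : 0 ≤ schattenNorm u X :=
  Real.rpow_nonneg (trace_mpow_nonneg (posSemidef_conjTranspose_mul_self X) _) _

lemma mul_suppProj_conjTranspose_mul_self (X : Matrix n n ℂ) : X * suppProj (Xᴴ * X) = X := by
  have hY := posSemidef_conjTranspose_mul_self X
  have h : (X * (1 - suppProj (Xᴴ * X)))ᴴ * (X * (1 - suppProj (Xᴴ * X))) = 0 := by
    rw [conjTranspose_mul, Matrix.mul_assoc, ← Matrix.mul_assoc Xᴴ X, Matrix.mul_sub (Xᴴ * X),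
      mul_suppProj hY]
    simp
  rw [conjTranspose_mul_self_eq_zero, Matrix.mul_sub, Matrix.mul_one, sub_eq_zero] at h
  exact h.symm

/-- The partial isometry `X |X|⁻¹` of the polar decomposition of `X`, with the pseudoinverse of
`|X|`. -/
noncomputable def polarPart (X : Matrix n n ℂ) : Matrix n n ℂ :=
  X * mcpow (Xᴴ * X) (-(1 / 2))

lemma polarPart_mul_mcpow (X : Matrix n n ℂ) : polarPart X * mcpow (Xᴴ * X) (1 / 2) = X := by
  rw [polarPart, Matrix.mul_assoc, mcpow_mul, neg_add_cancel]
  exact mul_suppProj_conjTranspose_mul_self X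

lemma polarPart_conjTranspose_mul (X : Matrix n n ℂ) :
    (polarPart X)ᴴ * polarPart X = suppProj (Xᴴ * X) := by
  have hY := posSemidef_conjTranspose_mul_self X
  have h1 : star (-(1 / 2) : ℂ) = -(1 / 2) := by simp
  rw [polarPart, conjTranspose_mul, mcpow_conjTranspose, h1, Matrix.mul_assoc,
    ← Matrix.mul_assoc Xᴴ X]
  nth_rewrite 2 [← mcpow_one hY]
  rw [mcpow_mul, mcpow_mul, suppProj]
  congr 1
  norm_num

section Interpolation

open scoped Matrix.Norms.L2Operator

lemma l2_opNorm_mcpow_le_one {M : Matrix n n ℂ} (hM : M.PosSemidef) {z : ℂ} (hz : z.re = 0) :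
    ‖mcpow M z‖ ≤ 1 := by
  refine l2_opNorm_fc_le_one hM.1 fun i => ?_
  rcases eq_or_ne (hM.1.eigenvalues i) 0 with h | h
  · simp [pseudoPow, h]
  · rw [norm_pseudoPow_of_ne (hM.eigenvalues_nonneg i) h, hz, Real.rpow_zero]

lemma l2_opNorm_polarPart_le_one (X : Matrix n n ℂ) : ‖polarPart X‖ ≤ 1 := by
  apply l2_opNorm_le_one_of_conjTranspose_mul
  rw [polarPart_conjTranspose_mul]
  exact l2_opNorm_mcpow_le_one (posSemidef_conjTranspose_mul_self X) rfl

/-- Hölder's inequality for Schatten norms, with contractions interspersed. The second factor is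
bounded spectrally, which keeps the exponent `v = 0` (the operator norm) within reach. -/
lemma norm_trace_mul_fc_le_schattenNorm {K C Q : Matrix n n ℂ} (X : Matrix n n ℂ)
    (hK : K.IsHermitian) (hC : ‖C‖ ≤ 1) (hQ : ‖Q‖ ≤ 1) {g : ℝ → ℂ} {y : n → ℝ}
    (hy : ∀ i, 0 ≤ y i) {u v : ℝ} (hu : 0 < u) (hv : 0 ≤ v) (huv : u + v = 1)
    (hg : ∀ i, ‖g (hK.eigenvalues i)‖ ≤ y i ^ v) :
    ‖(C * X * Q * fc K g).trace‖ ≤ schattenNorm u X * (∑ i, y i) ^ v := by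
  have hY := posSemidef_conjTranspose_mul_self X
  have e : C * X * Q * fc K g =
      (C * polarPart X) * fc (Xᴴ * X) (pseudoPow (1 / 2)) * Q * fc K g := by
    conv_lhs => rw [← polarPart_mul_mcpow X]
    simp only [mcpow, Matrix.mul_assoc]
  rw [e, schattenNorm, trace_mpow hY]
  refine norm_trace_mul_fc_mul_fc_le hY.1 hK
    (l2_opNorm_mul_le_one hC (l2_opNorm_polarPart_le_one X)) hQ
    (fun i => Real.rpow_nonneg (hY.eigenvalues_nonneg i) _) hy hu.le hv huv (fun i => ?_) hg
  rcases eq_or_ne (hY.1.eigenvalues i) 0 with h | h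
  · rw [h]
    simp [pseudoPow]
    positivity
  · rw [norm_pseudoPow_of_ne (hY.eigenvalues_nonneg i) h, ← Real.rpow_mul (hY.eigenvalues_nonneg i)]
    apply le_of_eq
    congr 1
    field_simp
    norm_num

/-- Entire functions that are bounded on the strip `0 ≤ re z ≤ 1`. -/
def StripBounded (f : ℂ → ℂ) : Prop :=
  Differentiable ℂ f ∧ ∃ B, ∀ z : ℂ, 0 ≤ z.re → z.re ≤ 1 → ‖f z‖ ≤ B

lemma stripBounded_const (c : ℂ) : StripBounded fun _ => c :=
  ⟨differentiable_const c, ‖c‖, fun _ _ _ => le_rfl⟩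

lemma StripBounded.mul {f g : ℂ → ℂ} (hf : StripBounded f) (hg : StripBounded g) :
    StripBounded fun z => f z * g z := by
  obtain ⟨hf, B, hB⟩ := hf
  obtain ⟨hg, C, hC⟩ := hg
  refine ⟨hf.mul hg, B * C, fun z h0 h1 => ?_⟩
  rw [norm_mul]
  exact mul_le_mul (hB z h0 h1) (hC z h0 h1) (norm_nonneg _)
    ((norm_nonneg _).trans (hB z h0 h1))

lemma StripBounded.sum {ι : Type*} {s : Finset ι} {f : ι → ℂ → ℂ}
    (hf : ∀ i ∈ s, StripBounded (f i)) : StripBounded fun z => ∑ i ∈ s, f i z := by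
  refine ⟨Differentiable.fun_sum fun i hi => (hf i hi).1, ?_⟩
  choose! B hB using fun i hi => (hf i hi).2
  exact ⟨∑ i ∈ s, B i, fun z h0 h1 =>
    (norm_sum_le _ _).trans (Finset.sum_le_sum fun i hi => hB i hi z h0 h1)⟩

lemma stripBounded_pseudoPow (p q x : ℝ) :
    StripBounded fun z => pseudoPow (p + z * q) x := by
  unfold pseudoPow
  split_ifs with h
  · exact stripBounded_const 0
  · refine ⟨by fun_prop, Real.exp (|p * Real.log x| + |q * Real.log x|), fun z h0 h1 => ?_⟩
    rw [Complex.norm_exp, Real.exp_le_exp]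
    have : ((p + z * q) * (Real.log x : ℂ)).re = p * Real.log x + z.re * (q * Real.log x) := by
      simp; ring
    rw [this]
    refine add_le_add (le_abs_self _) ?_
    calc z.re * (q * Real.log x) ≤ z.re * |q * Real.log x| :=
          mul_le_mul_of_nonneg_left (le_abs_self _) h0
      _ ≤ 1 * |q * Real.log x| := mul_le_mul_of_nonneg_right h1 (abs_nonneg _)
      _ = _ := one_mul _

/-- Matrix-valued families with entries bounded on the strip. -/
def MatrixStripBounded {k : Type*} (T : ℂ → Matrix k k ℂ) : Prop :=
  ∀ i j, StripBounded fun z => T z i j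

lemma matrixStripBounded_const {k : Type*} (M : Matrix k k ℂ) : MatrixStripBounded fun _ => M :=
  fun _ _ => stripBounded_const _

lemma MatrixStripBounded.mul {k : Type*} [Fintype k] {S T : ℂ → Matrix k k ℂ} (hS : MatrixStripBounded S)
    (hT : MatrixStripBounded T) : MatrixStripBounded fun z => S z * T z := fun i j => by
  simp only [mul_apply]
  exact StripBounded.sum fun k _ => (hS i k).mul (hT k j)

lemma MatrixStripBounded.kronecker {k m : Type*} {S : ℂ → Matrix k k ℂ}
    {T : ℂ → Matrix m m ℂ} (hS : MatrixStripBounded S) (hT : MatrixStripBounded T) :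
    MatrixStripBounded fun z => S z ⊗ₖ T z := fun i j =>
  (hS i.1 j.1).mul (hT i.2 j.2)

lemma matrixStripBounded_mcpow {M : Matrix n n ℂ} (hM : M.IsHermitian) (p q : ℝ) :
    MatrixStripBounded fun z => mcpow M (p + z * q) := by
  simp only [mcpow, fc_eq hM]
  refine ((matrixStripBounded_const _).mul fun i j => ?_).mul (matrixStripBounded_const _)
  by_cases h : i = j
  · subst h
    simpa using stripBounded_pseudoPow p q _
  · simpa [h] using stripBounded_const 0

lemma MatrixStripBounded.trace {k : Type*} [Fintype k] {T : ℂ → Matrix k k ℂ} (hT : MatrixStripBounded T) :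
    StripBounded fun z => (T z).trace :=
  StripBounded.sum fun i _ => hT i i

/-- Hadamard's three lines theorem for entire functions bounded on the strip. -/
lemma StripBounded.norm_le {f : ℂ → ℂ} (hf : StripBounded f) {a b θ : ℝ} (h0 : 0 ≤ θ) (h1 : θ ≤ 1)
    (ha : ∀ z : ℂ, z.re = 0 → ‖f z‖ ≤ a) (hb : ∀ z : ℂ, z.re = 1 → ‖f z‖ ≤ b) :
    ‖f θ‖ ≤ a ^ (1 - θ) * b ^ θ := by
  have := Complex.HadamardThreeLines.norm_le_interp_of_mem_verticalClosedStrip' (f := f)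
    (z := (θ : ℂ)) (a := a) (b := b) zero_lt_one
    (by simp [Complex.HadamardThreeLines.verticalClosedStrip, h0, h1]) hf.1.diffContOnCl
    (by
      obtain ⟨B, hB⟩ := hf.2
      refine ⟨B, ?_⟩
      rintro _ ⟨z, hz, rfl⟩
      exact hB z hz.1 hz.2)
    (fun z hz => ha z hz) (fun z hz => hb z hz)
  simpa using this

/-- Complex interpolation for Schatten norms of an analytic family which on each of the two boundary
lines is, up to contractions on the right, a fixed matrix. -/
theorem schattenNorm_le_of_stripBounded {R T₀ T₁ : Matrix n n ℂ} {T : ℂ → Matrix n n ℂ}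
    (hT : MatrixStripBounded T)
    (h0 : ∀ z : ℂ, z.re = 0 → ∃ V : Matrix n n ℂ, ‖V‖ ≤ 1 ∧ T z = T₀ * V)
    (h1 : ∀ z : ℂ, z.re = 1 → ∃ V : Matrix n n ℂ, ‖V‖ ≤ 1 ∧ T z = T₁ * V)
    {u₀ u₁ θ : ℝ} (hu₀ : 0 < u₀) (hu₀' : u₀ ≤ 1) (hu₁ : 0 < u₁) (hu₁' : u₁ ≤ 1)
    (hθ : 0 ≤ θ) (hθ' : θ ≤ 1) :
    schattenNorm (u₀ + θ * (u₁ - u₀)) (R * T θ) ≤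
      schattenNorm u₀ (R * T₀) ^ (1 - θ) * schattenNorm u₁ (R * T₁) ^ θ := by
  set u := u₀ + θ * (u₁ - u₀) with hu
  have hupos : 0 < u := by
    rw [show u = (1 - θ) * u₀ + θ * u₁ by rw [hu]; ring]
    rcases eq_or_lt_of_le hθ with h | h
    · rw [← h]; simpa using hu₀
    · have := mul_nonneg (by linarith : 0 ≤ 1 - θ) hu₀.le
      have := mul_pos h hu₁
      linarith
  set X := R * T θ with hX
  set Y := Xᴴ * X with hYdef
  have hY : Y.PosSemidef := posSemidef_conjTranspose_mul_self X
  set M := (mpow Y (1 / (2 * u))).trace.re with hM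
  have hMsum : M = ∑ i, hY.1.eigenvalues i ^ (1 / (2 * u)) := trace_mpow hY _
  have hM0 : 0 ≤ M := trace_mpow_nonneg hY _
  set N₀ := schattenNorm u₀ (R * T₀) with hN₀
  set N₁ := schattenNorm u₁ (R * T₁) with hN₁
  have hN₀0 : 0 ≤ N₀ := schattenNorm_nonneg _ _
  have hN₁0 : 0 ≤ N₁ := schattenNorm_nonneg _ _
  have hNN : 0 ≤ N₀ ^ (1 - θ) * N₁ ^ θ :=
    mul_nonneg (Real.rpow_nonneg hN₀0 _) (Real.rpow_nonneg hN₁0 _)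
  change M ^ u ≤ _
  rcases eq_or_lt_of_le hM0 with hMz | hMpos
  · rw [← hMz, Real.zero_rpow hupos.ne']
    exact hNN
  -- the dual family: `W θ` is proportional to the matrix norming `X`
  let W : ℂ → Matrix n n ℂ := fun z =>
    mcpow Y (((1 - u₀) / (2 * u) : ℝ) + z * ((u₀ - u₁) / (2 * u) : ℝ)) * (polarPart X)ᴴ
  let f : ℂ → ℂ := fun z => (R * T z * W z).trace
  have hf : StripBounded f :=
    (((matrixStripBounded_const R).mul hT).mul ((matrixStripBounded_mcpow hY.1 _ _).mul
      (matrixStripBounded_const _))).trace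
  -- the bound on either boundary line
  have hbd : ∀ (z : ℂ) (T' V : Matrix n n ℂ) (w : ℝ), ‖V‖ ≤ 1 → T z = T' * V → 0 < w → w ≤ 1 →
      (1 - u₀) / (2 * u) + z.re * ((u₀ - u₁) / (2 * u)) = (1 / (2 * u)) * (1 - w) →
      ‖f z‖ ≤ schattenNorm w (R * T') * M ^ (1 - w) := by
    intro z T' V w hV hTz hw hw' hexp
    have e : f z = ((polarPart X)ᴴ * (R * T') * V *
        fc Y (pseudoPow (((1 - u₀) / (2 * u) : ℝ) + z * ((u₀ - u₁) / (2 * u) : ℝ)))).trace := by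
      simp only [f, W, hTz, mcpow]
      rw [← Matrix.mul_assoc, trace_mul_comm]
      simp only [Matrix.mul_assoc]
    rw [e, hMsum]
    refine norm_trace_mul_fc_le_schattenNorm (R * T') hY.1
      (l2_opNorm_conjTranspose_le_one (l2_opNorm_polarPart_le_one X)) hV
      (fun i => Real.rpow_nonneg (hY.eigenvalues_nonneg i) _) hw (by linarith) (by ring)
      (fun i => ?_)
    rcases eq_or_ne (hY.1.eigenvalues i) 0 with h | h
    · simp only [pseudoPow, h, if_true, norm_zero]
      exact Real.rpow_nonneg (Real.rpow_nonneg le_rfl _) _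
    · rw [norm_pseudoPow_of_ne (hY.eigenvalues_nonneg i) h,
        ← Real.rpow_mul (hY.eigenvalues_nonneg i), ← hexp]
      apply le_of_eq
      congr 1
      simp only [Complex.add_re, Complex.ofReal_re, Complex.mul_re, Complex.ofReal_im, mul_zero,
        sub_zero]
  have key := hf.norm_le hθ hθ' (a := N₀ * M ^ (1 - u₀)) (b := N₁ * M ^ (1 - u₁))
    (fun z hz => by
      obtain ⟨V, hV, hTV⟩ := h0 z hz
      refine hbd z T₀ V u₀ hV hTV hu₀ hu₀' ?_
      rw [hz]
      ring)
    (fun z hz => by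
      obtain ⟨V, hV, hTV⟩ := h1 z hz
      refine hbd z T₁ V u₁ hV hTV hu₁ hu₁' ?_
      rw [hz]
      ring)
  have hfθ : f θ = (mpow Y (1 / (2 * u))).trace := by
    have e : f θ = ((polarPart X)ᴴ * polarPart X * (mcpow Y (1 / 2) *
        mcpow Y (((1 - u₀) / (2 * u) : ℝ) + θ * ((u₀ - u₁) / (2 * u) : ℝ)))).trace := by
      simp only [f, W]
      rw [← hX]
      nth_rewrite 1 [← polarPart_mul_mcpow X]
      rw [← Matrix.mul_assoc, trace_mul_comm]
      simp only [Matrix.mul_assoc, hYdef]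
    have hexp : (1 / 2 : ℂ) + (((1 - u₀) / (2 * u) : ℝ) + θ * ((u₀ - u₁) / (2 * u) : ℝ)) =
        ((1 / (2 * u) : ℝ) : ℂ) := by
      have : (1 / 2 : ℝ) + ((1 - u₀) / (2 * u) + θ * ((u₀ - u₁) / (2 * u))) = 1 / (2 * u) := by
        field_simp
        rw [hu]
        ring
      rw [← this]
      push_cast
      ring
    rw [e, polarPart_conjTranspose_mul, mcpow_mul, suppProj_mul_mcpow, hexp,
      mpow_eq_mcpow hY (by positivity)]
  have hfM : M ≤ ‖f θ‖ := by
    rw [hfθ]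
    exact Complex.re_le_norm _
  have hle := hfM.trans key
  rw [Real.mul_rpow hN₀0 (Real.rpow_nonneg hM0 _), Real.mul_rpow hN₁0 (Real.rpow_nonneg hM0 _),
    ← Real.rpow_mul hM0, ← Real.rpow_mul hM0, mul_mul_mul_comm, ← Real.rpow_add hMpos,
    show (1 - u₀) * (1 - θ) + (1 - u₁) * θ = 1 - u by rw [hu]; ring, Real.rpow_sub hMpos,
    Real.rpow_one, mul_div_assoc', le_div_iff₀ (Real.rpow_pos_of_pos hMpos _), mul_comm] at hle
  exact le_of_mul_le_mul_right hle hMpos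

/-- Log-convexity of the Schatten norms of `R (τ ^ a ⊗ σ ^ b)` with exponent `1 / (1 / 2 + a)` along
lines in the `(a, b)`-plane. At the end points, support projections may be left out. -/
theorem schattenNorm_kronecker_le {m : Type*} [Fintype m] [DecidableEq m]
    {τ : Matrix n n ℂ} {σ : Matrix m m ℂ} (hτ : τ.PosSemidef) (hσ : σ.PosSemidef)
    (R S₀ S₁ : Matrix (n × m) (n × m) ℂ) {a₀ a₁ b₀ b₁ θ : ℝ}
    (ha₀ : -(1 / 2) < a₀) (ha₀' : a₀ ≤ 1 / 2) (ha₁ : -(1 / 2) < a₁) (ha₁' : a₁ ≤ 1 / 2)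
    (hS₀ : S₀ * (suppProj τ ⊗ₖ suppProj σ) = mcpow τ a₀ ⊗ₖ mcpow σ b₀)
    (hS₁ : S₁ * (suppProj τ ⊗ₖ suppProj σ) = mcpow τ a₁ ⊗ₖ mcpow σ b₁)
    (hθ : 0 ≤ θ) (hθ' : θ ≤ 1) :
    schattenNorm (1 / 2 + (a₀ + θ * (a₁ - a₀)))
      (R * (mcpow τ (a₀ + θ * (a₁ - a₀) : ℝ) ⊗ₖ mcpow σ (b₀ + θ * (b₁ - b₀) : ℝ))) ≤
      schattenNorm (1 / 2 + a₀) (R * S₀) ^ (1 - θ) * schattenNorm (1 / 2 + a₁) (R * S₁) ^ θ := by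
  let T : ℂ → Matrix (n × m) (n × m) ℂ := fun z =>
    mcpow τ (a₀ + z * (a₁ - a₀ : ℝ)) ⊗ₖ mcpow σ (b₀ + z * (b₁ - b₀ : ℝ))
  have hT : MatrixStripBounded T :=
    (matrixStripBounded_mcpow hτ.1 _ _).kronecker (matrixStripBounded_mcpow hσ.1 _ _)
  have hfac : ∀ (S : Matrix (n × m) (n × m) ℂ) (a b : ℝ) (z w w' : ℂ),
      S * (suppProj τ ⊗ₖ suppProj σ) = mcpow τ a ⊗ₖ mcpow σ b → w.re = 0 → w'.re = 0 →
      a₀ + z * (a₁ - a₀ : ℝ) = a + w → b₀ + z * (b₁ - b₀ : ℝ) = b + w' →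
      ∃ V : Matrix (n × m) (n × m) ℂ, ‖V‖ ≤ 1 ∧ T z = S * V := by
    intro S a b z w w' hS hw hw' ha hb
    refine ⟨mcpow τ w ⊗ₖ mcpow σ w', ?_, ?_⟩
    · have hcancel : ∀ {w : ℂ}, w.re = 0 → star w + w = 0 := fun {w} hw => by
        apply Complex.ext <;> simp [hw]
      apply l2_opNorm_le_one_of_conjTranspose_mul
      rw [conjTranspose_kronecker, ← mul_kronecker_mul, mcpow_conjTranspose, mcpow_conjTranspose,
        mcpow_mul, mcpow_mul, hcancel hw, hcancel hw', ← mcpow_kronecker hτ.1 hσ.1]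
      exact l2_opNorm_mcpow_le_one (hτ.kronecker hσ) rfl
    · rw [← suppProj_mul_mcpow τ w, ← suppProj_mul_mcpow σ w', mul_kronecker_mul,
        ← Matrix.mul_assoc, hS, ← mul_kronecker_mul, mcpow_mul, mcpow_mul]
      simp only [T, ha, hb]
  have key := schattenNorm_le_of_stripBounded (R := R) (T₀ := S₀) (T₁ := S₁) hT
    (fun z hz => hfac S₀ a₀ b₀ z (z * (a₁ - a₀ : ℝ)) (z * (b₁ - b₀ : ℝ)) hS₀
      (by simp [hz]) (by simp [hz]) rfl rfl)
    (fun z hz => hfac S₁ a₁ b₁ z ((z - 1) * (a₁ - a₀ : ℝ)) ((z - 1) * (b₁ - b₀ : ℝ)) hS₁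
      (by simp [hz]) (by simp [hz]) (by push_cast; ring) (by push_cast; ring))
    (u₀ := 1 / 2 + a₀) (u₁ := 1 / 2 + a₁) (θ := θ) (by linarith) (by linarith) (by linarith)
    (by linarith) hθ hθ'
  have e1 : 1 / 2 + a₀ + θ * (1 / 2 + a₁ - (1 / 2 + a₀)) = 1 / 2 + (a₀ + θ * (a₁ - a₀)) := by ring
  have e2 : T θ = mcpow τ (a₀ + θ * (a₁ - a₀) : ℝ) ⊗ₖ mcpow σ (b₀ + θ * (b₁ - b₀) : ℝ) := by
    simp only [T]
    push_cast
    rfl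
  rwa [e1, e2] at key

end Interpolation

end

/-! ### Rényi divergences, entropies and marginals -/

section Divergence

variable {n : Type*} [Fintype n] [DecidableEq n]

lemma mpow_half_conjTranspose_mul {ρ : Matrix n n ℂ} (hρ : ρ.PosSemidef) :
    (mpow ρ (1 / 2))ᴴ * mpow ρ (1 / 2) = ρ := by
  rw [(posSemidef_mpow hρ _).1.eq, mpow_eq_mcpow hρ (by norm_num), mcpow_mul,
    show (((1 / 2 : ℝ) : ℂ) + ((1 / 2 : ℝ) : ℂ)) = 1 by push_cast; norm_num, mcpow_one hρ]

lemma mpow_half_mul_self {ρ : Matrix n n ℂ} (hρ : ρ.PosSemidef) :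
    mpow ρ (1 / 2) * mpow ρ (1 / 2) = ρ := by
  conv_rhs => rw [← mpow_half_conjTranspose_mul hρ, (posSemidef_mpow hρ _).1.eq]

/-- Matrices that act trivially on `ρ` act trivially on its square root. -/
lemma mpow_half_mul_eq {ρ P : Matrix n n ℂ} (hρ : ρ.PosSemidef) (h : ρ * P = ρ) :
    mpow ρ (1 / 2) * P = mpow ρ (1 / 2) := by
  have e : mpow ρ (1 / 2) = mcpow ρ (-(1 / 2)) * ρ := by
    nth_rewrite 3 [← mcpow_one hρ]
    rw [mcpow_mul, mpow_eq_mcpow hρ (by norm_num)]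
    congr 1
    push_cast
    norm_num
  rw [e, Matrix.mul_assoc, h]

lemma schattenNorm_pos (u : ℝ) {X : Matrix n n ℂ} (hX : X ≠ 0) :
    0 < schattenNorm u X := by
  have hY := posSemidef_conjTranspose_mul_self X
  refine Real.rpow_pos_of_pos (lt_of_le_of_ne (trace_mpow_nonneg hY _) fun h => hX ?_) u
  rw [trace_mpow hY] at h
  have h0 : ∀ i, hY.1.eigenvalues i = 0 := fun i => by
    have := (Finset.sum_eq_zero_iff_of_nonneg fun i _ =>
      Real.rpow_nonneg (hY.eigenvalues_nonneg i) _).1 h.symm i (Finset.mem_univ i)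
    exact ((Real.rpow_eq_zero_iff_of_nonneg (hY.eigenvalues_nonneg i)).1 this).1
  have : hY.1.eigenvalues = 0 := funext h0
  rw [hY.1.eigenvalues_eq_zero_iff] at this
  exact conjTranspose_mul_self_eq_zero.1 this

lemma mpow_half_mul_mpow_ne_zero {ρ ω : Matrix n n ℂ} (hρ : ρ.PosSemidef) (hω : ω.PosSemidef)
    (h : ¬ Perp ρ ω) {a : ℝ} (ha : a ≠ 0) : mpow ρ (1 / 2) * mpow ω a ≠ 0 := by
  intro h0
  apply h
  rw [mpow_eq_mcpow hω ha] at h0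
  have h1 : ρ * ω = mpow ρ (1 / 2) * (mpow ρ (1 / 2) * mcpow ω a) * mcpow ω (1 - a) := by
    rw [Matrix.mul_assoc, Matrix.mul_assoc, mcpow_mul, add_sub_cancel, mcpow_one hω,
      ← Matrix.mul_assoc, mpow_half_mul_self hρ]
  rw [Perp, h1, h0]
  simp

lemma not_perp_of_dominates {ρ ω : Matrix n n ℂ} (hρ : IsDensity ρ) (hω : ω.PosSemidef)
    (h : ρ * suppProj ω = ρ) : ¬ Perp ρ ω := by
  intro h0
  have h1 : ρ = ρ * ω * mcpow ω (-1) := by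
    nth_rewrite 1 [← h]
    nth_rewrite 2 [← mcpow_one hω]
    rw [Matrix.mul_assoc, mcpow_mul, add_neg_cancel, suppProj]
  rw [Perp] at h0
  rw [h0, Matrix.zero_mul] at h1
  have := hρ.2
  rw [h1] at this
  simp at this

lemma logb_rpow_of_nonneg {x : ℝ} (hx : 0 ≤ x) {u : ℝ} (hu : u ≠ 0) :
    Real.logb 2 (x ^ u) = u * Real.logb 2 x := by
  rcases eq_or_lt_of_le hx with h | h
  · rw [← h, Real.zero_rpow hu]
    simp
  · exact Real.logb_rpow_eq_mul_logb_of_pos h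

/-- The sandwiched Rényi divergence of order `α = 1 / (1 + 2 a)` in terms of a Schatten norm. -/
lemma renyiDiv_eq_logb_schattenNorm {ρ ω : Matrix n n ℂ} (hρ : ρ.PosSemidef) (hω : ω.PosSemidef)
    {α a : ℝ} (hα : 0 < α) (hα1 : α ≠ 1) (ha : a = (1 - α) / (2 * α)) (hperp : ¬ Perp ρ ω)
    (h : Dominates ω ρ ∨ α < 1) :
    renyiDiv α ρ ω = ((-(Real.logb 2 (schattenNorm (1 / 2 + a) (mpow ρ (1 / 2) * mpow ω a)) / a)
      : ℝ) : EReal) := by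
  rw [renyiDiv, if_neg hα1, if_pos ⟨hperp, h⟩, EReal.coe_eq_coe_iff]
  have hu : 1 / 2 + a = 1 / (2 * α) := by rw [ha]; field_simp; ring
  have hX : (mpow ρ (1 / 2) * mpow ω a)ᴴ * (mpow ρ (1 / 2) * mpow ω a) =
      mpow ω a * ρ * mpow ω a := by
    rw [conjTranspose_mul, (posSemidef_mpow hω a).1.eq, Matrix.mul_assoc,
      ← Matrix.mul_assoc (mpow ρ (1 / 2))ᴴ, mpow_half_conjTranspose_mul hρ, ← Matrix.mul_assoc]
  have hpos : (mpow ω a * ρ * mpow ω a).PosSemidef := hX ▸ posSemidef_conjTranspose_mul_self _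
  rw [schattenNorm, hX, hu, show 1 / (2 * (1 / (2 * α))) = α by field_simp,
    logb_rpow_of_nonneg (trace_mpow_nonneg hpos _) (by positivity), ← ha, ha]
  have h1 : α - 1 ≠ 0 := sub_ne_zero.2 hα1
  have h2 : 1 - α ≠ 0 := sub_ne_zero.2 hα1.symm
  field_simp
  ring

lemma renyiDiv_one_eq {ρ ω : Matrix n n ℂ} (h : Dominates ω ρ) :
    renyiDiv 1 ρ ω = (((ρ * (mlog ρ - mlog ω)).trace.re : ℝ) : EReal) := by
  rw [renyiDiv, if_pos rfl, if_pos h]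

lemma renyiDiv_eq_top {α : ℝ} {ρ ω : Matrix n n ℂ} (hα : 1 ≤ α) (h : ¬ Dominates ω ρ) :
    renyiDiv α ρ ω = ⊤ := by
  rw [renyiDiv]
  split_ifs with h1 h2
  · rfl
  · exact absurd h2.2 (by simp [h, hα])
  · rfl

open scoped Matrix.Norms.L2Operator in
/-- The Schatten norm controls the relative entropy: Hölder's inequality against a power of `ρ`
leaves `tr ρ ^ (1 - a) ω ^ a`, to which Jensen's inequality applies. -/
lemma neg_mul_relEntropy_le_logb_schattenNorm {ρ ω : Matrix n n ℂ} (hρ : IsDensity ρ)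
    (hω : ω.PosSemidef) (hdom : ρ * suppProj ω = ρ) {a : ℝ} (ha0 : a ≠ 0) (ha : -(1 / 2) < a)
    (ha' : a ≤ 1 / 2) :
    -a * (ρ * (mlog ρ - mlog ω)).trace.re ≤
      Real.logb 2 (schattenNorm (1 / 2 + a) (mpow ρ (1 / 2) * mpow ω a)) := by
  have h1 := two_rpow_neg_mul_le_trace hρ hω hdom a
  have n1 : ‖(1 : Matrix n n ℂ)‖ ≤ 1 := l2_opNorm_le_one_of_unitary (by simp)
  have h2 := norm_trace_mul_fc_le_schattenNorm (mpow ρ (1 / 2) * mpow ω a) hρ.1.1 n1 n1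
    (g := pseudoPow (1 / 2 - a : ℝ)) (y := hρ.1.1.eigenvalues) hρ.1.eigenvalues_nonneg
    (u := 1 / 2 + a) (v := 1 / 2 - a) (by linarith) (by linarith) (by ring) (fun i => by
      rcases eq_or_ne (hρ.1.1.eigenvalues i) 0 with h | h
      · simp only [pseudoPow, h, if_true, norm_zero]
        exact Real.rpow_nonneg le_rfl _
      · rw [norm_pseudoPow_of_ne (hρ.1.eigenvalues_nonneg i) h, Complex.ofReal_re])
  rw [sum_eigenvalues_of_isDensity hρ, Real.one_rpow, mul_one, Matrix.one_mul] at h2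
  simp only [mul_one] at h2
  have e : (mpow ρ (1 / 2) * mpow ω a * fc ρ (pseudoPow (1 / 2 - a : ℝ))).trace =
      (mcpow ρ (1 - a : ℝ) * mcpow ω a).trace := by
    rw [trace_mul_comm, ← Matrix.mul_assoc, mpow_eq_mcpow hρ.1 (by norm_num),
      mpow_eq_mcpow hω ha0]
    change (mcpow ρ _ * _ * _).trace = _
    rw [mcpow_mul]
    congr 3
    push_cast
    ring
  rw [e] at h2
  have h3 := h1.trans ((Complex.re_le_norm _).trans h2)
  rw [Real.le_logb_iff_rpow_le one_lt_two ((Real.rpow_pos_of_pos two_pos _).trans_le h3)]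
  exact h3

lemma renyiDiv_le_renyiDiv_one {ρ ω : Matrix n n ℂ} (hρ : IsDensity ρ)
    (hω : ω.PosSemidef) (hdom : Dominates ω ρ) {α : ℝ} (hα : 1 / 2 ≤ α) (hα' : α ≤ 1) :
    renyiDiv α ρ ω ≤ renyiDiv 1 ρ ω := by
  rcases eq_or_lt_of_le hα' with rfl | hlt
  · exact le_rfl
  have hd := (dominates_iff hω).1 hdom
  have h0 : 0 < α := by linarith
  have ha : 0 < (1 - α) / (2 * α) := div_pos (by linarith) (by linarith)
  have ha' : (1 - α) / (2 * α) ≤ 1 / 2 := by rw [div_le_div_iff₀ (by linarith) two_pos]; linarith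
  rw [renyiDiv_eq_logb_schattenNorm hρ.1 hω h0 hlt.ne rfl (not_perp_of_dominates hρ hω hd)
    (Or.inl hdom), renyiDiv_one_eq hdom, EReal.coe_le_coe_iff]
  have := neg_mul_relEntropy_le_logb_schattenNorm hρ hω hd ha.ne' (by linarith) ha'
  rw [neg_le, le_div_iff₀ ha]
  linarith

lemma renyiDiv_one_le_renyiDiv {ρ ω : Matrix n n ℂ} (hρ : IsDensity ρ)
    (hω : ω.PosSemidef) {α : ℝ} (hα : 1 ≤ α) : renyiDiv 1 ρ ω ≤ renyiDiv α ρ ω := by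
  rcases eq_or_lt_of_le hα with rfl | hlt
  · exact le_rfl
  by_cases hdom : Dominates ω ρ
  swap
  · rw [renyiDiv_eq_top hα hdom]
    exact le_top
  have hd := (dominates_iff hω).1 hdom
  have h0 : 0 < α := by linarith
  have ha : (1 - α) / (2 * α) < 0 := div_neg_of_neg_of_pos (by linarith) (by linarith)
  have ha' : -(1 / 2) < (1 - α) / (2 * α) := by
    rw [lt_div_iff₀ (by linarith)]
    linarith
  rw [renyiDiv_eq_logb_schattenNorm hρ.1 hω h0 hlt.ne' rfl (not_perp_of_dominates hρ hω hd)
    (Or.inl hdom), renyiDiv_one_eq hdom, EReal.coe_le_coe_iff]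
  have := neg_mul_relEntropy_le_logb_schattenNorm hρ hω hd ha.ne ha' (by linarith)
  rw [← div_neg, le_div_iff₀ (by linarith)]
  linarith

end Divergence

section Entropy

variable {n : Type*} [Fintype n] [DecidableEq n]

lemma mcpow_one_matrix (z : ℂ) : mcpow (1 : Matrix n n ℂ) z = 1 := by
  have key := fc_conj_diagonal (U := (1 : Matrix n n ℂ)) (by simp) (fun _ => 1) (pseudoPow z)
  simpa [mcpow, pseudoPow, diagonal_one] using key

lemma mlog_one_matrix : mlog (1 : Matrix n n ℂ) = 0 := by
  have key := fc_conj_diagonal (U := (1 : Matrix n n ℂ)) (by simp) (fun _ => 1)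
    (fun x => ((Real.logb 2 x : ℝ) : ℂ))
  rw [mlog_eq_fc isHermitian_one]
  simpa using key

lemma pseudoPow_re_nonneg (p x : ℝ) : 0 ≤ (pseudoPow p x).re := by
  unfold pseudoPow
  split_ifs
  · simp
  · rw [← Complex.ofReal_mul, ← Complex.ofReal_exp, Complex.ofReal_re]
    exact (Real.exp_pos _).le

lemma posSemidef_mcpow {M : Matrix n n ℂ} (h : M.PosSemidef) (p : ℝ) :
    (mcpow M p).PosSemidef := by
  rw [mcpow, funext (pseudoPow_ofReal_re p)]
  exact posSemidef_fc h fun x _ => pseudoPow_re_nonneg p x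

lemma trace_mcpow_re_pos {ρ : Matrix n n ℂ} (hρ : IsDensity ρ) (p : ℝ) :
    0 < (mcpow ρ p).trace.re := by
  have h := two_rpow_neg_mul_le_trace hρ (PosSemidef.one (n := n) (R := ℂ))
    (by rw [suppProj, mcpow_one_matrix, Matrix.mul_one]) (1 - p)
  rw [mcpow_one_matrix, Matrix.mul_one, sub_sub_cancel] at h
  exact (Real.rpow_pos_of_pos two_pos _).trans_le h

lemma renyiEntropy_eq_logb_trace_mcpow {ρ : Matrix n n ℂ} (hρ : IsDensity ρ) {γ : ℝ}
    (h1 : γ ≠ 1) : renyiEntropy γ ρ = 1 / (1 - γ) * Real.logb 2 (mcpow ρ γ).trace.re := by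
  rw [renyiEntropy]
  split_ifs with h0
  · subst h0
    rw [mcpow, trace_fc hρ.1.1, hρ.1.1.rank_eq_card_non_zero_eigs, Fintype.card_subtype]
    simp [pseudoPow, Finset.sum_ite]
  · rw [mpow_eq_mcpow hρ.1 h0]

lemma mul_renyiEntropy_one_le {ρ : Matrix n n ℂ} (hρ : IsDensity ρ) (γ : ℝ) :
    (1 - γ) * renyiEntropy 1 ρ ≤ Real.logb 2 (mcpow ρ γ).trace.re := by
  have h := two_rpow_neg_mul_le_trace hρ (PosSemidef.one (n := n) (R := ℂ))
    (by rw [suppProj, mcpow_one_matrix, Matrix.mul_one]) (1 - γ)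
  rw [mcpow_one_matrix, Matrix.mul_one, sub_sub_cancel, mlog_one_matrix, sub_zero] at h
  rw [Real.le_logb_iff_rpow_le one_lt_two (trace_mcpow_re_pos hρ γ), renyiEntropy,
    if_neg one_ne_zero, if_pos rfl]
  refine le_trans (le_of_eq ?_) h
  congr 1
  ring

lemma renyiEntropy_le_renyiEntropy_one {ρ : Matrix n n ℂ} (hρ : IsDensity ρ) {γ : ℝ}
    (h : 1 ≤ γ) : renyiEntropy γ ρ ≤ renyiEntropy 1 ρ := by
  rcases eq_or_lt_of_le h with rfl | hlt
  · exact le_rfl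
  have := mul_renyiEntropy_one_le hρ γ
  rw [renyiEntropy_eq_logb_trace_mcpow hρ hlt.ne', one_div_mul_eq_div,
    div_le_iff_of_neg (by linarith)]
  linarith

lemma renyiEntropy_one_le_renyiEntropy {ρ : Matrix n n ℂ} (hρ : IsDensity ρ) {γ : ℝ}
    (h : γ ≤ 1) : renyiEntropy 1 ρ ≤ renyiEntropy γ ρ := by
  rcases eq_or_lt_of_le h with rfl | hlt
  · exact le_rfl
  have := mul_renyiEntropy_one_le hρ γ
  rw [renyiEntropy_eq_logb_trace_mcpow hρ hlt.ne, one_div_mul_eq_div,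
    le_div_iff₀ (by linarith)]
  linarith

end Entropy

section Marginal

variable {A B : Type*} [Fintype A] [DecidableEq A] [Fintype B] [DecidableEq B]

lemma trace_marginalB {A B : Type*} [Fintype A] [Fintype B] (ρ : Matrix (A × B) (A × B) ℂ) : (marginalB ρ).trace = ρ.trace := by
  simp only [trace, marginalB, diag_apply, of_apply, Fintype.sum_prod_type]
  rw [Finset.sum_comm]

lemma marginalB_mul_one_kronecker {A B : Type*} [Fintype A] [DecidableEq A] [Fintype B]
    (ρ : Matrix (A × B) (A × B) ℂ) (M : Matrix B B ℂ) :
    marginalB (ρ * ((1 : Matrix A A ℂ) ⊗ₖ M)) = marginalB ρ * M := by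
  ext j k
  simp only [marginalB, of_apply, mul_apply, Fintype.sum_prod_type, kronecker_apply, one_apply,
    ite_mul, one_mul, zero_mul, mul_ite, mul_zero, Finset.sum_mul]
  conv_rhs => rw [Finset.sum_comm]
  refine Finset.sum_congr rfl fun i _ => ?_
  rw [Finset.sum_comm]
  simp

lemma trace_mul_one_kronecker {A B : Type*} [Fintype A] [DecidableEq A] [Fintype B]
    (ρ : Matrix (A × B) (A × B) ℂ) (M : Matrix B B ℂ) :
    (ρ * ((1 : Matrix A A ℂ) ⊗ₖ M)).trace = (marginalB ρ * M).trace := by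
  rw [← trace_marginalB, marginalB_mul_one_kronecker]

lemma posSemidef_marginalB {A B : Type*} [Fintype A] {ρ : Matrix (A × B) (A × B) ℂ} (h : ρ.PosSemidef) :
    (marginalB ρ).PosSemidef := by
  have : marginalB ρ = ∑ i, ρ.submatrix (fun j => (i, j)) (fun j => (i, j)) := by
    ext j k
    simp [marginalB, Matrix.sum_apply]
  rw [this]
  exact posSemidef_sum _ fun i _ => h.submatrix _

lemma IsDensity.marginalB {A B : Type*} [Fintype A] [Fintype B] {ρ : Matrix (A × B) (A × B) ℂ} (h : IsDensity ρ) :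
    IsDensity (marginalB ρ) :=
  ⟨posSemidef_marginalB h.1, (trace_marginalB ρ).trans h.2⟩

/-- A positive semidefinite matrix is supported on the support of its marginal. -/
lemma mul_one_kronecker_suppProj_marginalB {ρ : Matrix (A × B) (A × B) ℂ} (h : ρ.PosSemidef) :
    ρ * ((1 : Matrix A A ℂ) ⊗ₖ suppProj (marginalB ρ)) = ρ := by
  set Q : Matrix (A × B) (A × B) ℂ := 1 - (1 : Matrix A A ℂ) ⊗ₖ suppProj (marginalB ρ) with hQ
  have hQ' : Q = (1 : Matrix A A ℂ) ⊗ₖ (1 - suppProj (marginalB ρ)) := by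
    rw [hQ, ← one_kronecker_one (m := A) (n := B), eq_comm, eq_sub_iff_add_eq, ← kronecker_add,
      sub_add_cancel]
  have hQQ : Q * Qᴴ = Q := by
    have hP : suppProj (marginalB ρ) * suppProj (marginalB ρ) = suppProj (marginalB ρ) :=
      suppProj_mul_mcpow _ 0
    rw [hQ', conjTranspose_kronecker, ← mul_kronecker_mul, conjTranspose_sub,
      suppProj_conjTranspose, conjTranspose_one, conjTranspose_one, Matrix.mul_sub,
      Matrix.sub_mul _ _ (suppProj (marginalB ρ)), hP]
    simp
  have h0 : ((mpow ρ (1 / 2) * Q)ᴴ * (mpow ρ (1 / 2) * Q)).trace = 0 := by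
    rw [conjTranspose_mul, Matrix.mul_assoc, trace_mul_comm, ← Matrix.mul_assoc,
      mpow_half_conjTranspose_mul h, Matrix.mul_assoc, hQQ, hQ', trace_mul_one_kronecker,
      Matrix.mul_sub, mul_suppProj (posSemidef_marginalB h)]
    simp
  rw [trace_conjTranspose_mul_self_eq_zero_iff] at h0
  have h1 : ρ * Q = 0 := by
    rw [← mpow_half_mul_self h, Matrix.mul_assoc, h0, Matrix.mul_zero]
  rw [hQ, Matrix.mul_sub, Matrix.mul_one, sub_eq_zero] at h1
  exact h1.symm

lemma suppProj_kronecker {τ : Matrix A A ℂ} {σ : Matrix B B ℂ} (hτ : τ.PosSemidef)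
    (hσ : σ.PosSemidef) : suppProj (τ ⊗ₖ σ) = suppProj τ ⊗ₖ suppProj σ :=
  mcpow_kronecker hτ.1 hσ.1 0

lemma suppProj_mul_suppProj {n : Type*} [Fintype n] [DecidableEq n] (M : Matrix n n ℂ) :
    suppProj M * suppProj M = suppProj M :=
  suppProj_mul_mcpow M 0

lemma suppProj_one {n : Type*} [Fintype n] [DecidableEq n] : suppProj (1 : Matrix n n ℂ) = 1 :=
  mcpow_one_matrix 0

/-- Domination by a product splits into domination by either factor. -/
lemma mul_suppProj_kronecker_iff {τ : Matrix A A ℂ} {σ : Matrix B B ℂ}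
    (ρ : Matrix (A × B) (A × B) ℂ) :
    ρ * (suppProj τ ⊗ₖ suppProj σ) = ρ ↔
      ρ * (suppProj τ ⊗ₖ 1) = ρ ∧ ρ * (1 ⊗ₖ suppProj σ) = ρ := by
  constructor
  · intro h
    constructor
    · conv_lhs => rw [← h]
      rw [Matrix.mul_assoc, ← mul_kronecker_mul, suppProj_mul_suppProj, Matrix.mul_one, h]
    · conv_lhs => rw [← h]
      rw [Matrix.mul_assoc, ← mul_kronecker_mul, suppProj_mul_suppProj, Matrix.mul_one, h]
  · rintro ⟨h1, h2⟩
    have : suppProj τ ⊗ₖ suppProj σ = (suppProj τ ⊗ₖ (1 : Matrix B B ℂ)) *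
        ((1 : Matrix A A ℂ) ⊗ₖ suppProj σ) := by
      rw [← mul_kronecker_mul, Matrix.mul_one, Matrix.one_mul]
    rw [this, ← Matrix.mul_assoc, h1, h2]

end Marginal

/-! ### Escort states and the three collinear points -/

section

section Escort

variable {n : Type*} [Fintype n] [DecidableEq n]

/-- The escort state `ρ ^ γ / tr ρ ^ γ`; for `γ = 0` it is the normalized support projection. -/
noncomputable def escort (ρ : Matrix n n ℂ) (γ : ℝ) : Matrix n n ℂ :=
  (((mcpow ρ γ).trace.re⁻¹ : ℝ) : ℂ) • mcpow ρ γ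

lemma isDensity_escort {ρ : Matrix n n ℂ} (hρ : IsDensity ρ) (γ : ℝ) :
    IsDensity (escort ρ γ) := by
  have hc := trace_mcpow_re_pos hρ γ
  have hP := posSemidef_mcpow hρ.1 γ
  constructor
  · refine hP.smul ?_
    exact_mod_cast (inv_pos.2 hc).le
  · have him : ((mcpow ρ γ).trace.re : ℂ) = (mcpow ρ γ).trace := by
      apply Complex.ext
      · simp
      · rw [Complex.ofReal_im]
        exact (Complex.nonneg_iff.1 hP.trace_nonneg).2
    rw [escort, trace_smul, smul_eq_mul, ← him, ← Complex.ofReal_mul, Complex.ofReal_re,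
      inv_mul_cancel₀ hc.ne', Complex.ofReal_one]

lemma pseudoPow_pseudoPow (p q x : ℝ) : pseudoPow p (pseudoPow q x).re = pseudoPow (q * p) x := by
  rcases eq_or_ne x 0 with h | h
  · simp [pseudoPow, h]
  · have h1 : (pseudoPow q x).re = Real.exp (q * Real.log x) := by
      rw [pseudoPow, if_neg h, ← Complex.ofReal_mul, ← Complex.ofReal_exp, Complex.ofReal_re]
    rw [h1, pseudoPow, if_neg (Real.exp_pos _).ne', Real.log_exp, pseudoPow, if_neg h]
    congr 1
    push_cast
    ring

lemma mcpow_escort {ρ : Matrix n n ℂ} (hρ : IsDensity ρ) (γ p : ℝ) :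
    mcpow (escort ρ γ) p =
      (((mcpow ρ γ).trace.re ^ (-p) : ℝ) : ℂ) • mcpow ρ (γ * p : ℝ) := by
  have hc := trace_mcpow_re_pos hρ γ
  set c := (mcpow ρ γ).trace.re with hcdef
  have e : escort ρ γ = fc ρ (fun x => ((c⁻¹ * (pseudoPow γ x).re : ℝ) : ℂ)) := by
    rw [escort, ← hcdef, mcpow, ← fc_const_mul]
    congr 1
    funext x
    rw [pseudoPow_ofReal_re γ x]
    push_cast
    rfl
  rw [e, mcpow, fc_fc hρ.1.1, mcpow, ← fc_const_mul]
  congr 1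
  funext x
  rw [pseudoPow_ofReal_mul, pseudoPow_pseudoPow, Complex.ofReal_mul]
  congr 1
  rw [pseudoPow, if_neg (inv_ne_zero hc.ne'), Real.log_inv, Real.rpow_def_of_pos hc]
  push_cast
  congr 1
  ring

lemma suppProj_escort {ρ : Matrix n n ℂ} (hρ : IsDensity ρ) (γ : ℝ) :
    suppProj (escort ρ γ) = suppProj ρ := by
  have := mcpow_escort hρ γ 0
  simpa [suppProj] using this

end Escort

section Interpolation

variable {A B : Type*} [Fintype A] [DecidableEq A] [Fintype B] [DecidableEq B]

lemma logb_le_of_le_rpow_mul_rpow {x y z θ : ℝ} (hx : 0 < x) (hy : 0 ≤ y) (hz : 0 ≤ z)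
    (h0 : 0 < θ) (h1 : θ < 1) (h : x ≤ y ^ (1 - θ) * z ^ θ) :
    Real.logb 2 x ≤ (1 - θ) * Real.logb 2 y + θ * Real.logb 2 z := by
  have hy' : 0 < y := by
    refine lt_of_le_of_ne hy fun h' => ?_
    rw [← h', Real.zero_rpow (by linarith), zero_mul] at h
    linarith
  have hz' : 0 < z := by
    refine lt_of_le_of_ne hz fun h' => ?_
    rw [← h', Real.zero_rpow h0.ne', mul_zero] at h
    linarith
  have := Real.logb_le_logb_of_le one_lt_two hx h
  rwa [Real.logb_mul (Real.rpow_pos_of_pos hy' _).ne' (Real.rpow_pos_of_pos hz' _).ne',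
    Real.logb_rpow_eq_mul_logb_of_pos hy', Real.logb_rpow_eq_mul_logb_of_pos hz'] at this

variable {τ : Matrix A A ℂ} {σ : Matrix B B ℂ}

lemma mpow_kronecker_one_eq (hτ : τ.PosSemidef) {a : ℝ} (ha : a ≠ 0) :
    mpow (τ ⊗ₖ (1 : Matrix B B ℂ)) a = mcpow τ a ⊗ₖ 1 := by
  rw [mpow_kronecker hτ PosSemidef.one, mpow_one_matrix, mpow_eq_mcpow hτ ha]

lemma mpow_kronecker_eq (hτ : τ.PosSemidef) (hσ : σ.PosSemidef) {a : ℝ} (ha : a ≠ 0) :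
    mpow (τ ⊗ₖ σ) a = mcpow τ a ⊗ₖ mcpow σ a := by
  rw [mpow_kronecker hτ hσ, mpow_eq_mcpow hτ ha, mpow_eq_mcpow hσ ha]

lemma mpow_kronecker_one_mul_suppProj (hτ : τ.PosSemidef) {a : ℝ} (ha : a ≠ 0) :
    mpow (τ ⊗ₖ (1 : Matrix B B ℂ)) a * (suppProj τ ⊗ₖ suppProj σ) =
      mcpow τ a ⊗ₖ mcpow σ (0 : ℝ) := by
  rw [mpow_kronecker_one_eq hτ ha, ← mul_kronecker_mul, mcpow_mul_suppProj, Matrix.one_mul,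
    suppProj, Complex.ofReal_zero]

lemma mpow_kronecker_mul_suppProj (hτ : τ.PosSemidef) (hσ : σ.PosSemidef)
    {a : ℝ} (ha : a ≠ 0) :
    mpow (τ ⊗ₖ σ) a * (suppProj τ ⊗ₖ suppProj σ) = mcpow τ a ⊗ₖ mcpow σ a := by
  rw [mpow_kronecker_eq hτ hσ ha, ← mul_kronecker_mul, mcpow_mul_suppProj, mcpow_mul_suppProj]

lemma one_kronecker_mcpow_mul_suppProj (τ : Matrix A A ℂ) (σ : Matrix B B ℂ) (b : ℝ) :
    ((1 : Matrix A A ℂ) ⊗ₖ mcpow σ b) * (suppProj τ ⊗ₖ suppProj σ) =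
      mcpow τ (0 : ℝ) ⊗ₖ mcpow σ b := by
  rw [← mul_kronecker_mul, mcpow_mul_suppProj, Matrix.one_mul, suppProj, Complex.ofReal_zero]


lemma div_pos_of_mul_pos {x y : ℝ} (h : 0 < x * y) : 0 < x / y := by
  rcases pos_and_pos_or_neg_and_neg_of_mul_pos h with ⟨hx, hy⟩ | ⟨hx, hy⟩
  · exact div_pos hx hy
  · exact div_pos_of_neg_of_neg hx hy

lemma div_neg_of_mul_neg {x y : ℝ} (h : x * y < 0) : x / y < 0 := by
  rcases mul_neg_iff.1 h with ⟨hx, hy⟩ | ⟨hx, hy⟩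
  · exact div_neg_of_pos_of_neg hx hy
  · exact div_neg_of_neg_of_pos hx hy

/-- The combination of the logarithms of the three Schatten norms at the collinear points `(a, 0)`,
`(a', a')` and `(0, b)`, where `1 / a + 1 / b = 1 / a'`. Its sign is decided by which of the three
points lies between the other two. -/
noncomputable def decompositionGap (R : Matrix (A × B) (A × B) ℂ) (τ : Matrix A A ℂ)
    (σ : Matrix B B ℂ) (a a' b : ℝ) : ℝ :=
  -(Real.logb 2 (schattenNorm (1 / 2 + a') (R * mpow (τ ⊗ₖ σ) a')) / a') +
    Real.logb 2 (schattenNorm (1 / 2) (R * ((1 : Matrix A A ℂ) ⊗ₖ mcpow σ b))) / b +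
    Real.logb 2 (schattenNorm (1 / 2 + a) (R * mpow (τ ⊗ₖ (1 : Matrix B B ℂ)) a)) / a

variable {R : Matrix (A × B) (A × B) ℂ} {a a' b : ℝ}

/-- The point `(a, 0)` lies between `(0, b)` and `(a', a')`. -/
lemma mul_decompositionGap_nonpos_of_left (hτ : τ.PosSemidef) (hσ : σ.PosSemidef)
    (ha' : -(1 / 2) < a') (ha'' : a' ≤ 1 / 2)
    (hrel : b * a' + a * a' = a * b) (haa : 0 < a * a') (hab : a * b < 0)
    (hR : R * ((1 : Matrix A A ℂ) ⊗ₖ suppProj σ) = R)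
    (hpos : 0 < schattenNorm (1 / 2 + a) (R * mpow (τ ⊗ₖ (1 : Matrix B B ℂ)) a)) :
    a * decompositionGap R τ σ a a' b ≤ 0 := by
  have ha0 : a ≠ 0 := left_ne_zero_of_mul haa.ne'
  have ha'0 : a' ≠ 0 := right_ne_zero_of_mul haa.ne'
  have hb0 : b ≠ 0 := right_ne_zero_of_mul hab.ne
  have hθ : 0 < a / a' := div_pos_of_mul_pos haa
  have hθ1 : 1 - a / a' = -(a / b) := by field_simp; linarith
  have hθ' : a / a' < 1 := by linarith [div_neg_of_mul_neg hab]
  have key := schattenNorm_kronecker_le hτ hσ R _ _ (a₀ := 0) (a₁ := a') (b₀ := b) (b₁ := a')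
    (by norm_num) (by norm_num) ha' ha'' (one_kronecker_mcpow_mul_suppProj τ σ b)
    (mpow_kronecker_mul_suppProj hτ hσ ha'0) hθ.le hθ'.le
  rw [show (0 : ℝ) + a / a' * (a' - 0) = a by field_simp; ring,
    show b + a / a' * (a' - b) = 0 by field_simp; linarith,
    ← mpow_kronecker_one_mul_suppProj (σ := σ) hτ ha0, add_zero] at key
  have hmid : R * (mpow (τ ⊗ₖ (1 : Matrix B B ℂ)) a * (suppProj τ ⊗ₖ suppProj σ)) =
      R * mpow (τ ⊗ₖ (1 : Matrix B B ℂ)) a := by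
    rw [mpow_kronecker_one_eq hτ ha0, ← mul_kronecker_mul, mcpow_mul_suppProj, Matrix.one_mul]
    nth_rewrite 2 [← hR]
    rw [Matrix.mul_assoc, ← mul_kronecker_mul, Matrix.one_mul, Matrix.mul_one]
  rw [hmid] at key
  have := logb_le_of_le_rpow_mul_rpow hpos (schattenNorm_nonneg _ _) (schattenNorm_nonneg _ _)
    hθ hθ' key
  rw [hθ1] at this
  have e : ∀ x y z : ℝ, a * (-(x / a') + y / b + z / a) = -(a / a' * x) + a / b * y + z :=
    fun x y z => by field_simp
  rw [decompositionGap, e]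
  linarith

/-- The point `(0, b)` lies between `(a, 0)` and `(a', a')`. -/
lemma mul_decompositionGap_nonpos_of_right (hτ : τ.PosSemidef) (hσ : σ.PosSemidef)
    (ha : -(1 / 2) < a) (ha1 : a ≤ 1 / 2) (ha' : -(1 / 2) < a') (ha'' : a' ≤ 1 / 2)
    (hrel : b * a' + a * a' = a * b) (hab' : 0 < b * a') (hab : b * a < 0)
    (hR : R * (suppProj τ ⊗ₖ (1 : Matrix B B ℂ)) = R)
    (hpos : 0 < schattenNorm (1 / 2) (R * ((1 : Matrix A A ℂ) ⊗ₖ mcpow σ b))) :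
    b * decompositionGap R τ σ a a' b ≤ 0 := by
  have ha0 : a ≠ 0 := right_ne_zero_of_mul hab.ne
  have ha'0 : a' ≠ 0 := right_ne_zero_of_mul hab'.ne'
  have hb0 : b ≠ 0 := left_ne_zero_of_mul hab.ne
  have hθ : 0 < b / a' := div_pos_of_mul_pos hab'
  have hθ1 : 1 - b / a' = -(b / a) := by field_simp; linarith
  have hθ' : b / a' < 1 := by linarith [div_neg_of_mul_neg hab]
  have key := schattenNorm_kronecker_le hτ hσ R _ _ (a₀ := a) (a₁ := a') (b₀ := 0) (b₁ := a')
    ha ha1 ha' ha'' (mpow_kronecker_one_mul_suppProj (σ := σ) hτ ha0)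
    (mpow_kronecker_mul_suppProj hτ hσ ha'0) hθ.le hθ'.le
  rw [show a + b / a' * (a' - a) = 0 by field_simp; linarith,
    show (0 : ℝ) + b / a' * (a' - 0) = b by field_simp; ring,
    ← one_kronecker_mcpow_mul_suppProj τ σ b, add_zero] at key
  have hmid : R * (((1 : Matrix A A ℂ) ⊗ₖ mcpow σ b) * (suppProj τ ⊗ₖ suppProj σ)) =
      R * ((1 : Matrix A A ℂ) ⊗ₖ mcpow σ b) := by
    rw [← mul_kronecker_mul, mcpow_mul_suppProj, Matrix.one_mul]
    nth_rewrite 2 [← hR]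
    rw [Matrix.mul_assoc, ← mul_kronecker_mul, Matrix.one_mul, Matrix.mul_one]
  rw [hmid] at key
  have := logb_le_of_le_rpow_mul_rpow hpos (schattenNorm_nonneg _ _) (schattenNorm_nonneg _ _)
    hθ hθ' key
  rw [hθ1] at this
  have e : ∀ x y z : ℝ, b * (-(x / a') + y / b + z / a) = -(b / a' * x) + y + b / a * z :=
    fun x y z => by field_simp
  rw [decompositionGap, e]
  linarith

/-- The point `(a', a')` lies between `(a, 0)` and `(0, b)`. -/
lemma mul_decompositionGap_nonneg_of_middle (hτ : τ.PosSemidef) (hσ : σ.PosSemidef)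
    (ha : -(1 / 2) < a) (ha1 : a ≤ 1 / 2)
    (hrel : b * a' + a * a' = a * b) (hab' : 0 < a' * b) (haa : 0 < a' * a)
    (hpos : 0 < schattenNorm (1 / 2 + a') (R * mpow (τ ⊗ₖ σ) a')) :
    0 ≤ a' * decompositionGap R τ σ a a' b := by
  have ha0 : a ≠ 0 := right_ne_zero_of_mul haa.ne'
  have ha'0 : a' ≠ 0 := left_ne_zero_of_mul haa.ne'
  have hb0 : b ≠ 0 := right_ne_zero_of_mul hab'.ne'
  have hθ : 0 < a' / b := div_pos_of_mul_pos hab'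
  have hθ1 : 1 - a' / b = a' / a := by field_simp; linarith
  have hθ' : a' / b < 1 := by linarith [div_pos_of_mul_pos haa]
  have key := schattenNorm_kronecker_le hτ hσ R _ _ (a₀ := a) (a₁ := 0) (b₀ := 0) (b₁ := b)
    ha ha1 (by norm_num) (by norm_num) (mpow_kronecker_one_mul_suppProj (σ := σ) hτ ha0)
    (one_kronecker_mcpow_mul_suppProj τ σ b) hθ.le hθ'.le
  rw [show a + a' / b * (0 - a) = a' by field_simp; linarith,
    show (0 : ℝ) + a' / b * (b - 0) = a' by field_simp; ring,
    ← mpow_kronecker_eq hτ hσ ha'0, add_zero] at key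
  have := logb_le_of_le_rpow_mul_rpow hpos (schattenNorm_nonneg _ _) (schattenNorm_nonneg _ _)
    hθ hθ' key
  rw [hθ1] at this
  have e : ∀ x y z : ℝ, a' * (-(x / a') + y / b + z / a) = -x + a' / b * y + a' / a * z :=
    fun x y z => by field_simp
  rw [decompositionGap, e]
  linarith

/-- The Schatten 2-norm at the point `(0, b)` only depends on the marginal. -/
lemma schattenNorm_half_sq {ρ : Matrix (A × B) (A × B) ℂ} (hρ : ρ.PosSemidef)
    (σ : Matrix B B ℂ) (b : ℝ) :
    schattenNorm (1 / 2) (mpow ρ (1 / 2) * ((1 : Matrix A A ℂ) ⊗ₖ mcpow σ b)) ^ 2 =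
      (marginalB ρ * mcpow σ (2 * b : ℝ)).trace.re := by
  set X := mpow ρ (1 / 2) * ((1 : Matrix A A ℂ) ⊗ₖ mcpow σ b) with hX
  have hY := posSemidef_conjTranspose_mul_self X
  have e : (Xᴴ * X).trace = (marginalB ρ * mcpow σ (2 * b : ℝ)).trace := by
    rw [hX, conjTranspose_mul, Matrix.mul_assoc, trace_mul_comm, ← Matrix.mul_assoc,
      mpow_half_conjTranspose_mul hρ, Matrix.mul_assoc, conjTranspose_kronecker,
      ← mul_kronecker_mul, mcpow_conjTranspose, mcpow_mul, conjTranspose_one, Matrix.one_mul,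
      trace_mul_one_kronecker]
    congr 3
    simp only [Complex.star_def, Complex.conj_ofReal]
    push_cast
    ring
  rw [schattenNorm, ← Real.rpow_natCast, ← Real.rpow_mul (trace_mpow_nonneg hY _),
    show (1 : ℝ) / (2 * (1 / 2)) = 1 by norm_num, mpow_one hY.1, e]
  norm_num

lemma mpow_half_mul_one_kronecker_mcpow_ne_zero {ρ : Matrix (A × B) (A × B) ℂ}
    (hρ : ρ.PosSemidef) (hτ : τ.PosSemidef) (hσ : σ.PosSemidef) (h : ¬ Perp ρ (τ ⊗ₖ σ)) (b : ℝ) :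
    mpow ρ (1 / 2) * ((1 : Matrix A A ℂ) ⊗ₖ mcpow σ b) ≠ 0 := by
  intro h0
  apply mpow_half_mul_mpow_ne_zero hρ (hτ.kronecker hσ) h one_ne_zero
  have : mpow (τ ⊗ₖ σ) 1 = ((1 : Matrix A A ℂ) ⊗ₖ mcpow σ b) * (τ ⊗ₖ mcpow σ (1 - b)) := by
    rw [← mul_kronecker_mul, mcpow_mul, add_sub_cancel, mcpow_one hσ, Matrix.one_mul,
      mpow_one (hτ.kronecker hσ).1]
  rw [this, ← Matrix.mul_assoc, h0, Matrix.zero_mul]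

lemma not_perp_kronecker_one {ρ : Matrix (A × B) (A × B) ℂ} (h : ¬ Perp ρ (τ ⊗ₖ σ)) :
    ¬ Perp ρ (τ ⊗ₖ (1 : Matrix B B ℂ)) := by
  intro h0
  apply h
  have : τ ⊗ₖ σ = (τ ⊗ₖ (1 : Matrix B B ℂ)) * ((1 : Matrix A A ℂ) ⊗ₖ σ) := by
    rw [← mul_kronecker_mul, Matrix.mul_one, Matrix.one_mul]
  rw [Perp] at h0 ⊢
  rw [this, ← Matrix.mul_assoc, h0, Matrix.zero_mul]

lemma not_perp_kronecker {ρ : Matrix (A × B) (A × B) ℂ} (hσ : σ.PosSemidef)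
    (hR : ρ * ((1 : Matrix A A ℂ) ⊗ₖ suppProj σ) = ρ)
    (h : ¬ Perp ρ (τ ⊗ₖ (1 : Matrix B B ℂ))) : ¬ Perp ρ (τ ⊗ₖ σ) := by
  intro h0
  apply h
  have e : ((1 : Matrix A A ℂ) ⊗ₖ suppProj σ) * (τ ⊗ₖ (1 : Matrix B B ℂ)) =
      (τ ⊗ₖ σ) * ((1 : Matrix A A ℂ) ⊗ₖ mcpow σ (-1)) := by
    nth_rewrite 2 [← mcpow_one hσ]
    rw [← mul_kronecker_mul, ← mul_kronecker_mul, mcpow_mul, Matrix.one_mul, Matrix.mul_one,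
      Matrix.mul_one, add_neg_cancel, suppProj]
  rw [Perp] at h0 ⊢
  conv_lhs => rw [← hR]
  rw [Matrix.mul_assoc, e, ← Matrix.mul_assoc, h0, Matrix.zero_mul]

lemma dominates_kronecker_one_iff {ρ : Matrix (A × B) (A × B) ℂ} (hτ : τ.PosSemidef) :
    Dominates (τ ⊗ₖ (1 : Matrix B B ℂ)) ρ ↔ ρ * (suppProj τ ⊗ₖ (1 : Matrix B B ℂ)) = ρ := by
  rw [dominates_iff (hτ.kronecker PosSemidef.one), suppProj_kronecker hτ PosSemidef.one,
    suppProj_one]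

lemma dominates_kronecker_iff {ρ : Matrix (A × B) (A × B) ℂ} (hτ : τ.PosSemidef)
    (hσ : σ.PosSemidef) : Dominates (τ ⊗ₖ σ) ρ ↔
      Dominates (τ ⊗ₖ (1 : Matrix B B ℂ)) ρ ∧ ρ * ((1 : Matrix A A ℂ) ⊗ₖ suppProj σ) = ρ := by
  rw [dominates_iff (hτ.kronecker hσ), suppProj_kronecker hτ hσ, mul_suppProj_kronecker_iff,
    dominates_kronecker_one_iff hτ]

end Interpolation

end

/-! ### The lower bound -/

section

variable {A B : Type*} [Fintype A] [DecidableEq A] [Fintype B] [DecidableEq B]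

lemma renyiOrder_bounds {α : ℝ} (hα : 1 / 2 ≤ α) :
    -(1 / 2) < (1 - α) / (2 * α) ∧ (1 - α) / (2 * α) ≤ 1 / 2 := by
  constructor
  · rw [lt_div_iff₀ (by linarith)]
    linarith
  · rw [div_le_iff₀ (by linarith)]
    linarith

/-- The relation between the three orders, as collinearity of the interpolation points. -/
lemma interpolation_relation {α β γ : ℝ} (hα : α ≠ 0) (hβ : β ≠ 0) (hγ : γ ≠ 0)
    (hrel : α * β * γ - 2 * β * γ - α + β + γ = 0) :
    (γ - 1) / (2 * γ) * ((1 - β) / (2 * β)) + (1 - α) / (2 * α) * ((1 - β) / (2 * β)) =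
      (1 - α) / (2 * α) * ((γ - 1) / (2 * γ)) := by
  field_simp
  linear_combination hrel

lemma nonneg_of_mul_nonpos_of_neg {x y : ℝ} (hx : x < 0) (h : x * y ≤ 0) : 0 ≤ y := by
  by_contra! hy
  exact absurd (mul_pos_of_neg_of_neg hx hy) h.not_gt

lemma nonpos_of_mul_nonneg_of_neg {x y : ℝ} (hx : x < 0) (h : 0 ≤ x * y) : y ≤ 0 := by
  by_contra! hy
  exact absurd (mul_neg_of_neg_of_pos hx hy) h.not_gt

lemma nonpos_of_mul_nonpos_of_pos {x y : ℝ} (hx : 0 < x) (h : x * y ≤ 0) : y ≤ 0 := by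
  by_contra! hy
  exact absurd (mul_pos hx hy) h.not_gt

section NonDegenerate

variable {α β γ : ℝ} {ρ : Matrix (A × B) (A × B) ℂ} {τ : Matrix A A ℂ} {σ : Matrix B B ℂ}

/-- Lower bound on `D_β(ρ‖τ ⊗ σ)` for every state `σ`, when no order is `1`. -/
lemma renyiEntropy_add_renyiDiv_le (hα : 1 / 2 ≤ α) (hβ : 1 / 2 ≤ β) (hγ : 0 < γ)
    (hβ1 : β ≠ 1) (hγ1 : γ ≠ 1) (hβγ : 1 < β * γ)
    (hrel : α * β * γ - 2 * β * γ - α + β + γ = 0) (hρ : IsDensity ρ) (hτ : τ.PosSemidef)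
    (hsupp : (α < 1 ∧ β < 1) ∨ Dominates (τ ⊗ₖ (1 : Matrix B B ℂ)) ρ) (hσ : IsDensity σ) :
    (renyiEntropy γ (marginalB ρ) : EReal) + renyiDiv α ρ (τ ⊗ₖ (1 : Matrix B B ℂ)) ≤
      renyiDiv β ρ (τ ⊗ₖ σ) := by
  by_cases hfin : ¬ Perp ρ (τ ⊗ₖ σ) ∧ (Dominates (τ ⊗ₖ σ) ρ ∨ β < 1)
  swap
  · have : renyiDiv β ρ (τ ⊗ₖ σ) = ⊤ := by rw [renyiDiv, if_neg hβ1, if_neg hfin]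
    rw [this]
    exact le_top
  obtain ⟨hperp, hdom⟩ := hfin
  have hα0 : 0 < α := by linarith
  have hβ0 : 0 < β := by linarith
  have hfac : (α - 1) * (β * γ - 1) = (β - 1) * (γ - 1) := by linear_combination hrel
  have hα1 : α ≠ 1 := by
    rintro rfl
    rw [sub_self, zero_mul, eq_comm, mul_eq_zero, sub_eq_zero, sub_eq_zero] at hfac
    tauto
  have hτ1 := hτ.kronecker (PosSemidef.one (n := B) (R := ℂ))
  have hτσ := hτ.kronecker hσ.1
  have hperp1 := not_perp_kronecker_one hperp
  have hdom1 : Dominates (τ ⊗ₖ (1 : Matrix B B ℂ)) ρ ∨ α < 1 :=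
    hsupp.elim (fun h => Or.inr h.1) Or.inl
  rw [renyiDiv_eq_logb_schattenNorm hρ.1 hτ1 hα0 hα1 rfl hperp1 hdom1,
    renyiDiv_eq_logb_schattenNorm hρ.1 hτσ hβ0 hβ1 rfl hperp hdom, ← EReal.coe_add,
    EReal.coe_le_coe_iff]
  have hra := renyiOrder_bounds hα
  have hrb := renyiOrder_bounds hβ
  have hcol := interpolation_relation hα0.ne' hβ0.ne' hγ.ne' hrel
  set a := (1 - α) / (2 * α) with ha
  set a' := (1 - β) / (2 * β) with ha'
  set b := (γ - 1) / (2 * γ) with hb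
  set lγ := Real.logb 2 (schattenNorm (1 / 2)
    (mpow ρ (1 / 2) * ((1 : Matrix A A ℂ) ⊗ₖ mcpow σ b))) with hlγ
  have ha0 : a ≠ 0 := div_ne_zero (sub_ne_zero.2 hα1.symm) (by positivity)
  have ha'0 : a' ≠ 0 := div_ne_zero (sub_ne_zero.2 hβ1.symm) (by positivity)
  have hb0 : b ≠ 0 := div_ne_zero (sub_ne_zero.2 hγ1) (by positivity)
  have hNα := schattenNorm_pos (1 / 2 + a) (mpow_half_mul_mpow_ne_zero hρ.1 hτ1 hperp1 ha0)
  have hNβ := schattenNorm_pos (1 / 2 + a') (mpow_half_mul_mpow_ne_zero hρ.1 hτσ hperp ha'0)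
  have hNγ := schattenNorm_pos (1 / 2)
    (mpow_half_mul_one_kronecker_mcpow_ne_zero hρ.1 hτ hσ.1 hperp b)
  have h2b : 2 * b = (γ - 1) / γ := by rw [hb]; field_simp
  have hlγ2 : 2 * lγ = Real.logb 2 (marginalB ρ * mcpow σ ((γ - 1) / γ : ℝ)).trace.re := by
    rw [hlγ, ← h2b, ← schattenNorm_half_sq hρ.1, Real.logb_pow, Nat.cast_ofNat]
  have hc := trace_mcpow_re_pos hρ.marginalB γ
  have hmc : mpow (marginalB ρ) γ = mcpow (marginalB ρ) γ := mpow_eq_mcpow hρ.marginalB.1 hγ.ne'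
  have hHdiv : renyiEntropy γ (marginalB ρ) =
      -(1 / γ * Real.logb 2 (mcpow (marginalB ρ) γ).trace.re) / (2 * b) := by
    rw [renyiEntropy_eq_logb_trace_mcpow hρ.marginalB hγ1, h2b]
    have : 1 - γ ≠ 0 := sub_ne_zero.2 hγ1.symm
    have : γ - 1 ≠ 0 := sub_ne_zero.2 hγ1
    field_simp
    ring
  -- Hölder's inequality or its reverse bounds the term of the marginal
  have hent : lγ / b ≤ -renyiEntropy γ (marginalB ρ) := by
    have e : lγ / b = 2 * lγ / (2 * b) := by field_simp
    rw [hHdiv, neg_div, neg_neg, e, hlγ2, h2b]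
    rw [← logb_rpow_of_nonneg hc.le (by positivity)]
    rcases lt_or_gt_of_ne hγ1 with hlt | hgt
    · have hβgt : 1 < β := by nlinarith
      have hd := (dominates_kronecker_iff hτ hσ.1).1 (hdom.resolve_right (by linarith))
      have hd' : marginalB ρ * suppProj σ = marginalB ρ := by
        rw [← marginalB_mul_one_kronecker, hd.2]
      have := le_trace_mul_mcpow hρ.marginalB.1 hσ hd' hγ hlt
      rw [hmc] at this
      exact div_le_div_of_nonpos_of_le (div_neg_of_neg_of_pos (by linarith) hγ).le
        (Real.logb_le_logb_of_le one_lt_two (Real.rpow_pos_of_pos hc _) this)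
    · have := trace_mul_mcpow_le hρ.marginalB.1 hσ hgt
      rw [hmc] at this
      have hpos : 0 < (marginalB ρ * mcpow σ ((γ - 1) / γ : ℝ)).trace.re := by
        rw [← h2b, ← schattenNorm_half_sq hρ.1]
        exact pow_pos hNγ 2
      exact div_le_div_of_nonneg_right (Real.logb_le_logb_of_le one_lt_two hpos this)
        (div_pos (by linarith) hγ).le
  suffices hgap : 0 ≤ decompositionGap (mpow ρ (1 / 2)) τ σ a a' b by
    rw [decompositionGap, ← hlγ] at hgap
    linarith
  have sα : ∀ {x : ℝ}, 0 < x → x < 1 → 0 < (1 - x) / (2 * x) := fun h0 h1 =>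
    div_pos (by linarith) (by linarith)
  have sα' : ∀ {x : ℝ}, 0 < x → 1 < x → (1 - x) / (2 * x) < 0 := fun h0 h1 =>
    div_neg_of_neg_of_pos (by linarith) (by linarith)
  rcases lt_or_gt_of_ne hβ1 with hβlt | hβgt
  · -- `α, β < 1 < γ`
    have hγgt : 1 < γ := by nlinarith
    have hαlt : α < 1 := by nlinarith [mul_pos (sub_pos.2 hβlt) (sub_pos.2 hγgt)]
    have pa : 0 < a := sα hα0 hαlt
    have pa' : 0 < a' := sα hβ0 hβlt
    have pb : 0 < b := div_pos (by linarith) (by linarith)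
    exact nonneg_of_mul_nonneg_right (mul_decompositionGap_nonneg_of_middle hτ hσ.1 hra.1 hra.2
      hcol (mul_pos pa' pb) (mul_pos pa' pa) hNβ) pa'
  · have hd := (dominates_kronecker_iff hτ hσ.1).1 (hdom.resolve_right (by linarith))
    have pa' : a' < 0 := sα' hβ0 hβgt
    rcases lt_or_gt_of_ne hγ1 with hγlt | hγgt
    · -- `α, γ < 1 < β`
      have hαlt : α < 1 := by nlinarith [mul_pos (sub_pos.2 hβgt) (sub_pos.2 hγlt)]
      have pa : 0 < a := sα hα0 hαlt
      have pb : b < 0 := div_neg_of_neg_of_pos (by linarith) (by linarith)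
      have := mul_decompositionGap_nonpos_of_right hτ hσ.1 hra.1 hra.2 hrb.1 hrb.2 hcol
        (mul_pos_of_neg_of_neg pb pa') (mul_neg_of_neg_of_pos pb pa)
        (mpow_half_mul_eq hρ.1 ((dominates_kronecker_one_iff hτ).1 hd.1)) hNγ
      exact nonneg_of_mul_nonpos_of_neg pb this
    · -- all orders exceed `1`
      have hαgt : 1 < α := by nlinarith [mul_pos (sub_pos.2 hβgt) (sub_pos.2 hγgt)]
      have pa : a < 0 := sα' hα0 hαgt
      have pb : 0 < b := div_pos (by linarith) (by linarith)
      have := mul_decompositionGap_nonpos_of_left hτ hσ.1 hrb.1 hrb.2 hcol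
        (mul_pos_of_neg_of_neg pa pa') (mul_neg_of_neg_of_pos pa pb)
        (mpow_half_mul_eq hρ.1 hd.2) hNα
      exact nonneg_of_mul_nonpos_of_neg pa this

end NonDegenerate

end

/-! ### The upper bound and orders equal to one -/

section

variable {A B : Type*} [Fintype A] [DecidableEq A] [Fintype B] [DecidableEq B]

section UpperBound

variable {α β γ : ℝ} {ρ : Matrix (A × B) (A × B) ℂ} {τ : Matrix A A ℂ}

lemma mul_one_kronecker_suppProj_escort (hρ : IsDensity ρ) (γ : ℝ) :
    ρ * ((1 : Matrix A A ℂ) ⊗ₖ suppProj (escort (marginalB ρ) γ)) = ρ := by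
  rw [suppProj_escort hρ.marginalB, mul_one_kronecker_suppProj_marginalB hρ.1]

/-- The escort state of the marginal attains equality in Hölder's inequality. -/
lemma trace_marginalB_mul_mcpow_escort {ω : Matrix B B ℂ} (hω : IsDensity ω) (hγ : γ ≠ 0) :
    (ω * mcpow (escort ω γ) ((γ - 1) / γ : ℝ)).trace.re = (mcpow ω γ).trace.re ^ (1 / γ) := by
  have hc := trace_mcpow_re_pos hω γ
  have e : ω * mcpow ω (γ * ((γ - 1) / γ) : ℝ) = mcpow ω γ := by
    nth_rewrite 1 [← mcpow_one hω.1]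
    rw [mcpow_mul, mul_div_cancel₀ _ hγ]
    congr 1
    push_cast
    ring
  rw [mcpow_escort hω, Matrix.mul_smul, e, trace_smul, smul_eq_mul, Complex.re_ofReal_mul]
  nth_rewrite 2 [← Real.rpow_one (mcpow ω γ).trace.re]
  rw [← Real.rpow_add hc]
  congr 1
  field_simp
  ring

/-- Upper bound on `D_β(ρ‖τ ⊗ σ)` for the escort state `σ` of the marginal, when no order is `0`
or `1`. -/
lemma renyiDiv_escort_le (hα : 1 / 2 ≤ α) (hβ : 1 / 2 ≤ β) (hγ : 0 < γ)
    (hβ1 : β ≠ 1) (hγ1 : γ ≠ 1) (hβγ : β * γ < 1)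
    (hrel : α * β * γ - 2 * β * γ - α + β + γ = 0) (hρ : IsDensity ρ) (hτ : τ.PosSemidef)
    (hsupp : (α < 1 ∧ β < 1) ∨ Dominates (τ ⊗ₖ (1 : Matrix B B ℂ)) ρ) :
    renyiDiv β ρ (τ ⊗ₖ escort (marginalB ρ) γ) ≤
      (renyiEntropy γ (marginalB ρ) : EReal) + renyiDiv α ρ (τ ⊗ₖ (1 : Matrix B B ℂ)) := by
  have hα0 : 0 < α := by linarith
  have hβ0 : 0 < β := by linarith
  have hfac : (α - 1) * (β * γ - 1) = (β - 1) * (γ - 1) := by linear_combination hrel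
  have hα1 : α ≠ 1 := by
    rintro rfl
    rw [sub_self, zero_mul, eq_comm, mul_eq_zero, sub_eq_zero, sub_eq_zero] at hfac
    tauto
  by_cases hfin : ¬ Perp ρ (τ ⊗ₖ (1 : Matrix B B ℂ)) ∧
      (Dominates (τ ⊗ₖ (1 : Matrix B B ℂ)) ρ ∨ α < 1)
  swap
  · have : renyiDiv α ρ (τ ⊗ₖ (1 : Matrix B B ℂ)) = ⊤ := by
      rw [renyiDiv, if_neg hα1, if_neg hfin]
    rw [this, EReal.coe_add_top]
    exact le_top
  obtain ⟨hperp1, hdom1⟩ := hfin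
  have hσ := isDensity_escort hρ.marginalB γ
  have hR := mul_one_kronecker_suppProj_escort hρ γ
  have htr := trace_marginalB_mul_mcpow_escort hρ.marginalB hγ.ne'
  set σ := escort (marginalB ρ) γ with hσdef
  have hperp : ¬ Perp ρ (τ ⊗ₖ σ) := not_perp_kronecker hσ.1 hR hperp1
  have hdom : Dominates (τ ⊗ₖ σ) ρ ∨ β < 1 := by
    rcases hsupp with h | h
    · exact Or.inr h.2
    · exact Or.inl ((dominates_kronecker_iff hτ hσ.1).2 ⟨h, hR⟩)
  have hτ1 := hτ.kronecker (PosSemidef.one (n := B) (R := ℂ))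
  have hτσ := hτ.kronecker hσ.1
  rw [renyiDiv_eq_logb_schattenNorm hρ.1 hτ1 hα0 hα1 rfl hperp1 hdom1,
    renyiDiv_eq_logb_schattenNorm hρ.1 hτσ hβ0 hβ1 rfl hperp hdom, ← EReal.coe_add,
    EReal.coe_le_coe_iff]
  have hra := renyiOrder_bounds hα
  have hrb := renyiOrder_bounds hβ
  have hcol := interpolation_relation hα0.ne' hβ0.ne' hγ.ne' hrel
  set a := (1 - α) / (2 * α) with ha
  set a' := (1 - β) / (2 * β) with ha'
  set b := (γ - 1) / (2 * γ) with hb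
  set lγ := Real.logb 2 (schattenNorm (1 / 2)
    (mpow ρ (1 / 2) * ((1 : Matrix A A ℂ) ⊗ₖ mcpow σ b))) with hlγ
  have ha0 : a ≠ 0 := div_ne_zero (sub_ne_zero.2 hα1.symm) (by positivity)
  have ha'0 : a' ≠ 0 := div_ne_zero (sub_ne_zero.2 hβ1.symm) (by positivity)
  have hNα := schattenNorm_pos (1 / 2 + a) (mpow_half_mul_mpow_ne_zero hρ.1 hτ1 hperp1 ha0)
  have hNβ := schattenNorm_pos (1 / 2 + a') (mpow_half_mul_mpow_ne_zero hρ.1 hτσ hperp ha'0)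
  have hNγ := schattenNorm_pos (1 / 2)
    (mpow_half_mul_one_kronecker_mcpow_ne_zero hρ.1 hτ hσ.1 hperp b)
  have h2b : 2 * b = (γ - 1) / γ := by rw [hb]; field_simp
  have hlγ2 : 2 * lγ = 1 / γ * Real.logb 2 (mcpow (marginalB ρ) γ).trace.re := by
    rw [hlγ, ← logb_rpow_of_nonneg (trace_mcpow_re_pos hρ.marginalB γ).le (by positivity), ← htr,
      ← h2b, ← schattenNorm_half_sq hρ.1, Real.logb_pow, Nat.cast_ofNat]
  have hent : lγ / b = -renyiEntropy γ (marginalB ρ) := by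
    have e : lγ / b = 2 * lγ / (2 * b) := by
      have hb0 : b ≠ 0 := div_ne_zero (sub_ne_zero.2 hγ1) (by positivity)
      field_simp
    rw [e, hlγ2, renyiEntropy_eq_logb_trace_mcpow hρ.marginalB hγ1, h2b]
    have : 1 - γ ≠ 0 := sub_ne_zero.2 hγ1.symm
    have : γ - 1 ≠ 0 := sub_ne_zero.2 hγ1
    field_simp
    ring
  suffices hgap : decompositionGap (mpow ρ (1 / 2)) τ σ a a' b ≤ 0 by
    rw [decompositionGap, ← hlγ] at hgap
    linarith
  have sα : ∀ {x : ℝ}, 0 < x → x < 1 → 0 < (1 - x) / (2 * x) := fun h0 h1 =>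
    div_pos (by linarith) (by linarith)
  have sα' : ∀ {x : ℝ}, 0 < x → 1 < x → (1 - x) / (2 * x) < 0 := fun h0 h1 =>
    div_neg_of_neg_of_pos (by linarith) (by linarith)
  rcases lt_or_gt_of_ne hβ1 with hβlt | hβgt
  · have pa' : 0 < a' := sα hβ0 hβlt
    rcases lt_or_gt_of_ne hγ1 with hγlt | hγgt
    · -- all orders are below `1`
      have hαlt : α < 1 := by nlinarith [mul_pos (sub_pos.2 hβlt) (sub_pos.2 hγlt)]
      have pa : 0 < a := sα hα0 hαlt
      have pb : b < 0 := div_neg_of_neg_of_pos (by linarith) (by linarith)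
      exact nonpos_of_mul_nonpos_of_pos pa (mul_decompositionGap_nonpos_of_left hτ hσ.1 hrb.1 hrb.2
        hcol (mul_pos pa pa') (mul_neg_of_pos_of_neg pa pb) (mpow_half_mul_eq hρ.1 hR) hNα)
    · -- `β < 1 < α, γ`
      have hαgt : 1 < α := by nlinarith [mul_pos (sub_pos.2 hβlt) (sub_pos.2 hγgt)]
      have hd := hdom1.resolve_right (by linarith)
      have pa : a < 0 := sα' hα0 hαgt
      have pb : 0 < b := div_pos (by linarith) (by linarith)
      exact nonpos_of_mul_nonpos_of_pos pb (mul_decompositionGap_nonpos_of_right hτ hσ.1 hra.1 hra.2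
        hrb.1 hrb.2 hcol (mul_pos pb pa') (mul_neg_of_pos_of_neg pb pa)
        (mpow_half_mul_eq hρ.1 ((dominates_kronecker_one_iff hτ).1 hd)) hNγ)
  · -- `γ < 1 < α, β`
    have pa' : a' < 0 := sα' hβ0 hβgt
    have hγlt : γ < 1 := by nlinarith
    have hαgt : 1 < α := by nlinarith [mul_pos (sub_pos.2 hβgt) (sub_pos.2 hγlt)]
    have pa : a < 0 := sα' hα0 hαgt
    have pb : b < 0 := div_neg_of_neg_of_pos (by linarith) (by linarith)
    exact nonpos_of_mul_nonneg_of_neg pa' (mul_decompositionGap_nonneg_of_middle hτ hσ.1 hra.1 hra.2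
      hcol (mul_pos_of_neg_of_neg pa' pb) (mul_pos_of_neg_of_neg pa' pa) hNβ)

lemma fc_smul {n : Type*} [Fintype n] [DecidableEq n] {M : Matrix n n ℂ} (hM : M.IsHermitian)
    (c : ℝ) (f : ℝ → ℂ) : fc ((c : ℂ) • M) f = fc M (fun x => f (c * x)) := by
  rw [← fc_fc hM (fun x => c * x) f]
  congr 1
  conv_lhs => rw [← fc_id hM, ← fc_const_mul]
  push_cast
  rfl

lemma schattenNorm_smul {n : Type*} [Fintype n] [DecidableEq n] {u c : ℝ} (hu : 0 < u) (hc : 0 ≤ c)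
    (X : Matrix n n ℂ) : schattenNorm u ((c : ℂ) • X) = c * schattenNorm u X := by
  have hY := posSemidef_conjTranspose_mul_self X
  have e : ((c : ℂ) • X)ᴴ * ((c : ℂ) • X) = ((c ^ 2 : ℝ) : ℂ) • (Xᴴ * X) := by
    rw [conjTranspose_smul, Matrix.smul_mul, Matrix.mul_smul, smul_smul, Complex.star_def,
      Complex.conj_ofReal, ← Complex.ofReal_mul, sq]
  have hH : (((c ^ 2 : ℝ) : ℂ) • (Xᴴ * X)).IsHermitian := e ▸ isHermitian_conjTranspose_mul_self _
  have h1 : mpow (((c ^ 2 : ℝ) : ℂ) • (Xᴴ * X)) (1 / (2 * u)) =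
      (((c ^ 2) ^ (1 / (2 * u)) : ℝ) : ℂ) • mpow (Xᴴ * X) (1 / (2 * u)) := by
    rw [mpow_eq_fc hH, mpow_eq_fc hY.1, fc_smul hY.1, ← fc_const_mul]
    refine fc_congr hY fun x hx => ?_
    rw [Real.mul_rpow (sq_nonneg c) hx]
    push_cast
    rfl
  rw [schattenNorm, e, h1, trace_smul, smul_eq_mul, Complex.re_ofReal_mul,
    Real.mul_rpow (Real.rpow_nonneg (sq_nonneg c) _) (trace_mpow_nonneg hY _),
    ← Real.rpow_mul (sq_nonneg c), show 1 / (2 * u) * u = 1 / 2 by field_simp,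
    ← Real.sqrt_eq_rpow, Real.sqrt_sq hc, schattenNorm]

/-- For `γ = 0` the orders `α` and `β` agree, and the normalized projection onto the support of the
marginal only contributes a scalar factor. -/
lemma renyiDiv_escort_zero_le (hα : 1 / 2 ≤ α) (hα1 : α ≠ 1) (hρ : IsDensity ρ)
    (hτ : τ.PosSemidef) :
    renyiDiv α ρ (τ ⊗ₖ escort (marginalB ρ) 0) ≤
      (renyiEntropy 0 (marginalB ρ) : EReal) + renyiDiv α ρ (τ ⊗ₖ (1 : Matrix B B ℂ)) := by
  have hα0 : 0 < α := by linarith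
  by_cases hfin : ¬ Perp ρ (τ ⊗ₖ (1 : Matrix B B ℂ)) ∧
      (Dominates (τ ⊗ₖ (1 : Matrix B B ℂ)) ρ ∨ α < 1)
  swap
  · have : renyiDiv α ρ (τ ⊗ₖ (1 : Matrix B B ℂ)) = ⊤ := by
      rw [renyiDiv, if_neg hα1, if_neg hfin]
    rw [this, EReal.coe_add_top]
    exact le_top
  obtain ⟨hperp1, hdom1⟩ := hfin
  have hσ := isDensity_escort hρ.marginalB 0
  have hR := mul_one_kronecker_suppProj_escort hρ 0
  have hτ1 := hτ.kronecker (PosSemidef.one (n := B) (R := ℂ))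
  have hτσ := hτ.kronecker hσ.1
  have hperp := not_perp_kronecker hσ.1 hR hperp1
  have hdom : Dominates (τ ⊗ₖ escort (marginalB ρ) 0) ρ ∨ α < 1 :=
    hdom1.imp_left fun h => (dominates_kronecker_iff hτ hσ.1).2 ⟨h, hR⟩
  rw [renyiDiv_eq_logb_schattenNorm hρ.1 hτ1 hα0 hα1 rfl hperp1 hdom1,
    renyiDiv_eq_logb_schattenNorm hρ.1 hτσ hα0 hα1 rfl hperp hdom, ← EReal.coe_add,
    EReal.coe_le_coe_iff]
  have hra := renyiOrder_bounds hα
  set a := (1 - α) / (2 * α) with ha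
  have ha0 : a ≠ 0 := div_ne_zero (sub_ne_zero.2 hα1.symm) (by positivity)
  have hc := trace_mcpow_re_pos hρ.marginalB 0
  rw [renyiEntropy_eq_logb_trace_mcpow hρ.marginalB zero_ne_one]
  have hNα := schattenNorm_pos (1 / 2 + a) (mpow_half_mul_mpow_ne_zero hρ.1 hτ1 hperp1 ha0)
  have hX : mpow ρ (1 / 2) * mpow (τ ⊗ₖ escort (marginalB ρ) 0) a =
      (((mcpow (marginalB ρ) (0 : ℝ)).trace.re ^ (-a) : ℝ) : ℂ) •
        (mpow ρ (1 / 2) * mpow (τ ⊗ₖ (1 : Matrix B B ℂ)) a) := by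
    rw [mpow_kronecker_eq hτ hσ.1 ha0, mcpow_escort hρ.marginalB, kronecker_smul, Matrix.mul_smul,
      mpow_kronecker_one_eq hτ ha0]
    congr 1
    rw [suppProj_escort hρ.marginalB] at hR
    conv_rhs => rw [← mpow_half_mul_eq hρ.1 hR]
    rw [Matrix.mul_assoc, ← mul_kronecker_mul, Matrix.one_mul, Matrix.mul_one, zero_mul, suppProj,
      Complex.ofReal_zero]
  rw [hX, schattenNorm_smul (by linarith) (Real.rpow_nonneg hc.le _),
    Real.logb_mul (Real.rpow_pos_of_pos hc _).ne' hNα.ne', Real.logb_rpow_eq_mul_logb_of_pos hc]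
  apply le_of_eq
  field_simp
  ring

end UpperBound

section RelativeEntropy

variable {ρ : Matrix (A × B) (A × B) ℂ} {τ : Matrix A A ℂ} {σ : Matrix B B ℂ}

lemma mlog_kronecker (hτ : τ.IsHermitian) (hσ : σ.IsHermitian) :
    mlog (τ ⊗ₖ σ) = mlog τ ⊗ₖ suppProj σ + suppProj τ ⊗ₖ mlog σ := by
  have hτσ : (τ ⊗ₖ σ).IsHermitian := by
    rw [IsHermitian, conjTranspose_kronecker, hτ.eq, hσ.eq]
  rw [mlog_eq_fc hτσ, mlog_eq_fc hτ, mlog_eq_fc hσ, suppProj, suppProj, mcpow, mcpow,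
    fc_kronecker_eq hτ hσ, fc_kronecker_fc hτ hσ, fc_kronecker_fc hτ hσ, ← Matrix.add_mul,
    ← Matrix.mul_add, diagonal_add]
  congr 3
  funext p
  rcases eq_or_ne (hτ.eigenvalues p.1) 0 with h | h
  · simp [h, pseudoPow]
  rcases eq_or_ne (hσ.eigenvalues p.2) 0 with h' | h'
  · simp [h', pseudoPow]
  rw [Real.logb_mul h h']
  simp [pseudoPow, h, h']

/-- The chain rule for the quantum relative entropy relative to a product. -/
lemma relEntropy_kronecker (hτ : τ.PosSemidef) (hσ : σ.PosSemidef)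
    (hdom : Dominates (τ ⊗ₖ σ) ρ) :
    (ρ * (mlog ρ - mlog (τ ⊗ₖ σ))).trace.re =
      (ρ * (mlog ρ - mlog (τ ⊗ₖ (1 : Matrix B B ℂ)))).trace.re +
        renyiEntropy 1 (marginalB ρ) +
        (marginalB ρ * (mlog (marginalB ρ) - mlog σ)).trace.re := by
  obtain ⟨h1, h2⟩ := (dominates_kronecker_iff hτ hσ).1 hdom
  rw [dominates_kronecker_one_iff hτ] at h1
  have e1 : ρ * (mlog τ ⊗ₖ suppProj σ) = ρ * (mlog τ ⊗ₖ (1 : Matrix B B ℂ)) := by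
    conv_rhs => rw [← h2]
    rw [Matrix.mul_assoc, ← mul_kronecker_mul, Matrix.one_mul, Matrix.mul_one]
  have e2 : ρ * (suppProj τ ⊗ₖ mlog σ) = ρ * ((1 : Matrix A A ℂ) ⊗ₖ mlog σ) := by
    conv_rhs => rw [← h1]
    rw [Matrix.mul_assoc, ← mul_kronecker_mul, Matrix.one_mul, Matrix.mul_one]
  have e3 : mlog (τ ⊗ₖ (1 : Matrix B B ℂ)) = mlog τ ⊗ₖ (1 : Matrix B B ℂ) := by
    rw [mlog_kronecker hτ.1 isHermitian_one, suppProj_one, mlog_one_matrix, kronecker_zero,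
      add_zero]
  rw [e3, mlog_kronecker hτ.1 hσ.1, renyiEntropy, if_neg one_ne_zero, if_pos rfl]
  simp only [Matrix.mul_sub, Matrix.mul_add, e1, e2, trace_sub, trace_add, Complex.sub_re,
    Complex.add_re, trace_mul_one_kronecker]
  ring

end RelativeEntropy

section Degenerate

variable {α β γ : ℝ} {ρ : Matrix (A × B) (A × B) ℂ} {τ : Matrix A A ℂ} {σ : Matrix B B ℂ}

/-- The lower bound through the orders `1`, by monotonicity in every order. -/
lemma renyiEntropy_add_renyiDiv_le_of_le_one (hα : 1 / 2 ≤ α) (hα1 : α ≤ 1) (hβ : 1 ≤ β)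
    (hγ : 1 ≤ γ) (hρ : IsDensity ρ) (hτ : τ.PosSemidef) (hσ : IsDensity σ) :
    (renyiEntropy γ (marginalB ρ) : EReal) + renyiDiv α ρ (τ ⊗ₖ (1 : Matrix B B ℂ)) ≤
      renyiDiv β ρ (τ ⊗ₖ σ) := by
  by_cases hdom : Dominates (τ ⊗ₖ σ) ρ
  swap
  · rw [renyiDiv_eq_top hβ hdom]
    exact le_top
  have hd := (dominates_kronecker_iff hτ hσ.1).1 hdom
  have hmarg : marginalB ρ * suppProj σ = marginalB ρ := by
    rw [← marginalB_mul_one_kronecker, hd.2]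
  calc (renyiEntropy γ (marginalB ρ) : EReal) + renyiDiv α ρ (τ ⊗ₖ (1 : Matrix B B ℂ))
      ≤ (renyiEntropy 1 (marginalB ρ) : EReal) + renyiDiv 1 ρ (τ ⊗ₖ (1 : Matrix B B ℂ)) :=
        add_le_add (EReal.coe_le_coe_iff.2 (renyiEntropy_le_renyiEntropy_one hρ.marginalB hγ))
          (renyiDiv_le_renyiDiv_one hρ (hτ.kronecker PosSemidef.one) hd.1 hα hα1)
    _ ≤ renyiDiv 1 ρ (τ ⊗ₖ σ) := by
        rw [renyiDiv_one_eq hd.1, renyiDiv_one_eq hdom, ← EReal.coe_add, EReal.coe_le_coe_iff,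
          relEntropy_kronecker hτ hσ.1 hdom]
        linarith [trace_mul_mlog_sub_mlog_nonneg hρ.marginalB hσ hmarg]
    _ ≤ renyiDiv β ρ (τ ⊗ₖ σ) := renyiDiv_one_le_renyiDiv hρ (hτ.kronecker hσ.1) hβ

/-- The upper bound through the orders `1`, with the marginal itself as a candidate. -/
lemma renyiDiv_marginalB_le_of_one_le (hα : 1 ≤ α) (hβ : 1 / 2 ≤ β) (hβ1 : β ≤ 1)
    (hγ : γ ≤ 1) (hρ : IsDensity ρ) (hτ : τ.PosSemidef)
    (hdom : Dominates (τ ⊗ₖ (1 : Matrix B B ℂ)) ρ) :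
    renyiDiv β ρ (τ ⊗ₖ marginalB ρ) ≤
      (renyiEntropy γ (marginalB ρ) : EReal) + renyiDiv α ρ (τ ⊗ₖ (1 : Matrix B B ℂ)) := by
  have hσ := hρ.marginalB
  have hd : Dominates (τ ⊗ₖ marginalB ρ) ρ :=
    (dominates_kronecker_iff hτ hσ.1).2 ⟨hdom, mul_one_kronecker_suppProj_marginalB hρ.1⟩
  calc renyiDiv β ρ (τ ⊗ₖ marginalB ρ)
      ≤ renyiDiv 1 ρ (τ ⊗ₖ marginalB ρ) :=
        renyiDiv_le_renyiDiv_one hρ (hτ.kronecker hσ.1) hd hβ hβ1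
    _ = (renyiEntropy 1 (marginalB ρ) : EReal) + renyiDiv 1 ρ (τ ⊗ₖ (1 : Matrix B B ℂ)) := by
        rw [renyiDiv_one_eq hdom, renyiDiv_one_eq hd, ← EReal.coe_add, EReal.coe_eq_coe_iff,
          relEntropy_kronecker hτ hσ.1 hd]
        simp
        ring
    _ ≤ (renyiEntropy γ (marginalB ρ) : EReal) + renyiDiv α ρ (τ ⊗ₖ (1 : Matrix B B ℂ)) :=
        add_le_add (EReal.coe_le_coe_iff.2 (renyiEntropy_one_le_renyiEntropy hσ hγ))
          (renyiDiv_one_le_renyiDiv hρ (hτ.kronecker PosSemidef.one) hα)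

end Degenerate

end

end RenyiDecomp

open RenyiDecomp in
theorem theorem3p2 {A B : Type*} [Fintype A] [DecidableEq A] [Fintype B] [DecidableEq B]
    (α β γ : ℝ) (hα : 1 / 2 ≤ α) (hβ : 1 / 2 ≤ β) (hγ : 0 ≤ γ)
    (hrel : α * β * γ - 2 * β * γ - α + β + γ = 0)
    (ρ : Matrix (A × B) (A × B) ℂ) (hρ : IsDensity ρ)
    (τ : Matrix A A ℂ) (hτ : τ.PosSemidef)
    (hsupp : (α < 1 ∧ β < 1) ∨ Dominates (τ ⊗ₖ (1 : Matrix B B ℂ)) ρ) :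
    -- `1 / γ` stands for `+∞` when `γ = 0`; for `β = γ = 1` the order `α` fixes the direction
    ((0 < γ ∧ 1 / β + 1 / γ ≤ 2) → (β = 1 → γ = 1 → α ≤ 1) →
      mutualInfo β ρ τ ≥ (renyiEntropy γ (marginalB ρ) : EReal) - condEntropy α ρ τ) ∧
    ((γ = 0 ∨ 1 / β + 1 / γ ≥ 2) → (β = 1 → γ = 1 → 1 ≤ α) →
      mutualInfo β ρ τ ≤ (renyiEntropy γ (marginalB ρ) : EReal) - condEntropy α ρ τ) := by
  have hα0 : 0 < α := by linarith
  have hβ0 : 0 < β := by linarith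
  have hfac : (α - 1) * (β * γ - 1) = (β - 1) * (γ - 1) := by linear_combination hrel
  have hsum : α * (β * γ - 1) = 2 * (β * γ) - (β + γ) := by linear_combination hrel
  have hrhs : (renyiEntropy γ (marginalB ρ) : EReal) - condEntropy α ρ τ =
      (renyiEntropy γ (marginalB ρ) : EReal) + renyiDiv α ρ (τ ⊗ₖ (1 : Matrix B B ℂ)) := by
    rw [condEntropy, sub_eq_add_neg, neg_neg]
  -- the candidate `σ` gives an upper bound on the infimum
  have hinf : ∀ σ : Matrix B B ℂ, IsDensity σ → mutualInfo β ρ τ ≤ renyiDiv β ρ (τ ⊗ₖ σ) :=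
    fun σ hσ => iInf_le (fun σ : {σ : Matrix B B ℂ // IsDensity σ} =>
      renyiDiv β ρ (τ ⊗ₖ σ.1)) ⟨σ, hσ⟩
  rw [hrhs]
  have hfrac : 0 < γ → 1 / β + 1 / γ = (β + γ) / (β * γ) := fun h => by field_simp; ring
  constructor
  · rintro ⟨hγ0, hle⟩ hdir
    rw [hfrac hγ0, div_le_iff₀ (mul_pos hβ0 hγ0)] at hle
    have hβγ : 1 ≤ β * γ := by
      by_contra! h
      nlinarith
    refine le_iInf fun σ => ?_
    by_cases hdeg : β ≠ 1 ∧ γ ≠ 1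
    · refine renyiEntropy_add_renyiDiv_le hα hβ hγ0 hdeg.1 hdeg.2 (lt_of_le_of_ne hβγ fun h => ?_)
        hrel hρ hτ hsupp σ.2
      rw [← h, sub_self, mul_zero, eq_comm, mul_eq_zero, sub_eq_zero, sub_eq_zero] at hfac
      tauto
    · have hord : α ≤ 1 ∧ 1 ≤ β ∧ 1 ≤ γ := by
        rw [not_and_or, not_not, not_not] at hdeg
        rcases eq_or_ne α 1 with hα1 | hα1
        · rcases hdeg with h | h <;> subst h
          · exact ⟨hα1.le, le_rfl, by linarith⟩
          · exact ⟨hα1.le, by linarith, le_rfl⟩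
        · have h1 : β = 1 ∧ γ = 1 := by
            rcases hdeg with h | h <;> subst h
            · refine ⟨rfl, ?_⟩
              have : (α - 1) * (γ - 1) = 0 := by linarith
              exact sub_eq_zero.1 ((mul_eq_zero.1 this).resolve_left (sub_ne_zero.2 hα1))
            · refine ⟨?_, rfl⟩
              have : (α - 1) * (β - 1) = 0 := by linarith
              exact sub_eq_zero.1 ((mul_eq_zero.1 this).resolve_left (sub_ne_zero.2 hα1))
          exact ⟨hdir h1.1 h1.2, h1.1.ge, h1.2.ge⟩
      exact renyiEntropy_add_renyiDiv_le_of_le_one hα hord.1 hord.2.1 hord.2.2 hρ hτ σ.2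
  · intro hge hdir
    have hβγ : β * γ ≤ 1 := by
      rcases eq_or_lt_of_le hγ with h0 | hγ0
      · simp [← h0]
      · have hge' := hge.resolve_left hγ0.ne'
        rw [hfrac hγ0, ge_iff_le, le_div_iff₀ (mul_pos hβ0 hγ0)] at hge'
        by_contra! h
        nlinarith
    by_cases hdeg : β ≠ 1 ∧ γ ≠ 1
    · rcases eq_or_lt_of_le hγ with h0 | hγ0
      · subst h0
        obtain rfl : α = β := by linarith
        exact (hinf _ (isDensity_escort hρ.marginalB 0)).trans
          (renyiDiv_escort_zero_le hα hdeg.1 hρ hτ)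
      · refine (hinf _ (isDensity_escort hρ.marginalB γ)).trans (renyiDiv_escort_le hα hβ hγ0 hdeg.1
          hdeg.2 (lt_of_le_of_ne hβγ fun h => ?_) hrel hρ hτ hsupp)
        rw [h, sub_self, mul_zero, eq_comm, mul_eq_zero, sub_eq_zero, sub_eq_zero] at hfac
        tauto
    · have hord : 1 ≤ α ∧ β ≤ 1 ∧ γ ≤ 1 := by
        rw [not_and_or, not_not, not_not] at hdeg
        rcases eq_or_ne α 1 with hα1 | hα1
        · rcases hdeg with h | h <;> subst h
          · exact ⟨hα1.ge, le_rfl, by linarith⟩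
          · exact ⟨hα1.ge, by linarith, le_rfl⟩
        · have h1 : β = 1 ∧ γ = 1 := by
            rcases hdeg with h | h <;> subst h
            · refine ⟨rfl, ?_⟩
              have : (α - 1) * (γ - 1) = 0 := by linarith
              exact sub_eq_zero.1 ((mul_eq_zero.1 this).resolve_left (sub_ne_zero.2 hα1))
            · refine ⟨?_, rfl⟩
              have : (α - 1) * (β - 1) = 0 := by linarith
              exact sub_eq_zero.1 ((mul_eq_zero.1 this).resolve_left (sub_ne_zero.2 hα1))
          exact ⟨hdir h1.1 h1.2, h1.1.le, h1.2.le⟩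
      exact (hinf _ hρ.marginalB).trans (renyiDiv_marginalB_le_of_one_le hord.1 hβ hord.2.1
        hord.2.2 hρ hτ (hsupp.resolve_left fun h => by linarith [h.1]))
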